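/- Let $d\ge 1$. For a locally integrable $f:\mathbb R^d\to\mathbb R$, $p\in[1,\infty)$ and $a\in[0,1]$ put $$\|f\|^\sharp_{p,a}=\sup_B\Big(\frac1{|B|^{1+ap/d}}\int_B\Big|f-\frac1{|B|}\int_B f\Big|^p\,dy\Big)^{1/p},$$ the supremum being over all balls $B\subset\mathbb R^d$. Let $\|f\|_{\mathrm{BMO}}=\|f\|^\sharp_{1,0}$ and, for $a\in(0,1]$, $\|f\|_{\mathrm{Lip}_p(a)}=\|f\|^\sharp_{p,a}$; the spaces $\mathrm{BMO}$ and $\mathrm{Lip}_p(a)$ consist of the locally integrable $f$ for which the respective quantity is finite. Let $v:\mathbb R^d\to\mathbb R^d$ be Lipschitz with Lipschitz constant $\|v\|_{\mathrm{Lip}}$ and divergence free ($\nabla\cdot v=0$ almost everywhere), and consider the transport equation $$\partial_t u-v\cdot\nabla u=0\quad\text{on }[0,\infty)\times\mathbb R^d,\qquad u|_{t=0}=u_0 .$$ A weak solution is a function $u\in L^1_{\mathrm{loc}}([0,\infty)\times\mathbb R^d)$ such that $$\int_0^\infty\!\!\int_{\mathbb R^d}u\,(\partial_t\varphi-v\cdot\nabla\varphi)\,dx\,dt+\int_{\mathbb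 R^d}u_0\,\varphi(0,\cdot)\,dx=0\qquad\text{for all }\varphi\in C_c^\infty(\mathbb R\times\mathbb R^d).$$ For every $u_0\in L^1_{\mathrm{loc}}(\mathbb R^d)$ there is exactly one weak solution $u$, up to equality almost everywhere on $[0,\infty)\times\mathbb R^d$, and it has a representative with $u(t)\in L^1_{\mathrm{loc}}(\mathbb R^d)$ for every $t\ge0$ such that $t\mapsto\int u(t)\psi\,dx$ is continuous on $[0,\infty)$ for every $\psi\in C_c^\infty(\mathbb R^d)$. For any such representative: 1. If $u_0\in\mathrm{BMO}$, then $u(t)\in\mathrm{BMO}$ for all $t\ge0$, $\sup_{0\le t\le T}\|u(t)\|_{\mathrm{BMO}}<\infty$ for every $T\ge 0$, and $$\|u(t)\|_{\mathrm{BMO}}\le C\,(1+\|v\|_{\mathrm{Lip}}\,t)\,\|u_0\|_{\mathrm{BMO}}\qquad\text{for all }t\ge0,$$ with a constant $C$ that depends only on $d$. 2. If $u_0\in\mathrm{Lip}_p(a)$ for some $a\in(0,1]$ and $p\in(1,\infty)$, then $u(t)\in\mathrm{Lip}_p(a)$ for all $t\ge0$, $\sup_{0\le t\le T}\|u(t)\|_{\mathrm{Lip}_p(a)}<\infty$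 for every $T\ge 0$, and $$\|u(t)\|_{\mathrm{Lip}_p(a)}\le C\,e^{a\|v\|_{\mathrm{Lip}}t}\,\|u_0\|_{\mathrm{Lip}_p(a)}\qquad\text{for all }t\ge0,$$ with a constant $C$ that depends only on $d$, $a$ and $p$. -/

import Mathlib

open MeasureTheory Set
open scoped ENNReal NNReal ContDiff

noncomputable section

/-- Euclidean space `ℝ^d`. -/
abbrev Eucl (d : ℕ) : Type := EuclideanSpace ℝ (Fin d)

/-- The mean oscillation seminorm
`sup_B ( |B|^{-(1 + a p / d)} ∫_B |f - av_B f|^p )^{1/p}`, the supremum being over all balls `B`;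
it takes values in `[0, ∞]`. -/
def sharpNorm {d : ℕ} (p a : ℝ) (f : Eucl d → ℝ) : ℝ≥0∞ :=
  ⨆ (x : Eucl d) (r : ℝ) (_ : 0 < r),
    (volume (Metric.ball x r) ^ (-(1 + a * p / (d : ℝ))) *
      ∫⁻ y in Metric.ball x r, ‖f y - ⨍ z in Metric.ball x r, f z‖ₑ ^ p) ^ (1 / p)

/-- The `BMO` seminorm: mean oscillation with `p = 1` and `a = 0`. -/
def bmoNorm {d : ℕ} (f : Eucl d → ℝ) : ℝ≥0∞ := sharpNorm 1 0 f

/-- Membership in `BMO`. -/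
def MemBMO {d : ℕ} (f : Eucl d → ℝ) : Prop :=
  LocallyIntegrable f ∧ bmoNorm f < ⊤

/-- Membership in `Lip_p(a)`. -/
def MemLipSpace {d : ℕ} (p a : ℝ) (f : Eucl d → ℝ) : Prop :=
  LocallyIntegrable f ∧ sharpNorm p a f < ⊤

/-- The Lipschitz constant of a vector field, i.e. the least admissible one
(used for Lipschitz fields only). -/
def lipNorm {d : ℕ} (v : Eucl d → Eucl d) : ℝ≥0 := sInf {K : ℝ≥0 | LipschitzWith K v}

/-- A Lipschitz vector field with `∇ · v = 0`; a Lipschitz field is differentiable almost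
everywhere, and the divergence is required to vanish almost everywhere. -/
structure IsLipschitzDivFree {d : ℕ} (v : Eucl d → Eucl d) : Prop where
  lipschitz : ∃ K : ℝ≥0, LipschitzWith K v
  div_eq_zero : ∀ᵐ x : Eucl d, ∑ i : Fin d, fderiv ℝ v x (EuclideanSpace.single i 1) i = 0

/-- Smooth compactly supported functions. -/
def IsTestFunction {X : Type*} [NormedAddCommGroup X] [NormedSpace ℝ X] (φ : X → ℝ) : Prop :=
  ContDiff ℝ ∞ φ ∧ HasCompactSupport φ

/-- The space-time domain `[0, ∞) × ℝ^d`. -/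
def spaceTime (d : ℕ) : Set (ℝ × Eucl d) := Ici 0 ×ˢ univ

/-- `u ∈ L^1_loc([0, ∞) × ℝ^d)` is a weak solution of `∂_t u - v · ∇ u = 0`, `u|_{t=0} = u₀`,
for a divergence-free field `v` (so that `v · ∇ u = ∇ · (u v)`): for all test functions `φ`
(whose support may meet `t = 0`),
`∫∫_{t ≥ 0} u (∂_t φ - v · ∇ φ) dx dt + ∫ u₀ φ(0, ·) dx = 0`. -/
structure IsWeakSolution {d : ℕ} (v : Eucl d → Eucl d) (u₀ : Eucl d → ℝ)
    (u : ℝ → Eucl d → ℝ) : Prop where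
  locallyIntegrable :
    LocallyIntegrableOn (fun z : ℝ × Eucl d => u z.1 z.2) (spaceTime d)
  weak_eq : ∀ φ : ℝ × Eucl d → ℝ, IsTestFunction φ →
    (∫ z in spaceTime d, u z.1 z.2 * (fderiv ℝ φ z (1, 0) - fderiv ℝ φ z (0, v z.2)))
      + ∫ x, u₀ x * φ (0, x) = 0

/-- `u(t)` is defined as a locally integrable function for every time `t ≥ 0`, and depends on `t`
continuously in the sense of distributions. This singles out the values of a weak solution
at individual times. -/
structure IsWeaklyContinuous {d : ℕ} (u : ℝ → Eucl d → ℝ) : Prop where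
  locallyIntegrable : ∀ t : ℝ, 0 ≤ t → LocallyIntegrable (u t)
  continuousOn : ∀ ψ : Eucl d → ℝ, IsTestFunction ψ →
    ContinuousOn (fun t : ℝ => ∫ x, u t x * ψ x) (Ici 0)

end

/-! ### Global flow of a Lipschitz vector field. -/

section Flow

/-! Let `X` be the flow of `v`. Solutions are constant along the characteristics `t ↦ (t, X (-t)
y)`, so `u(t) = u₀ ∘ X t`. Since `v` is divergence free, `X t` preserves volume
(`IsFlow.measurePreserving`); by Gronwall it is Lipschitz with constant `e^s`, `s = ‖v‖_Lip t`. Both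
estimates therefore concern composition with a volume-preserving, `e^s`-Lipschitz homeomorphism `Φ`.

Such a `Φ` maps a ball `B` of radius `r` to a set `E` with `|E| = |B|` inside a ball `B'` of radius
`e^s r`. For `Lip_p(a)`, Campanato's estimate (`MeanOscLE.ae_abs_sub_setAverage_le`) puts `f` almost
everywhere on `B'` within `C ‖f‖ (e^s r)^a` of one constant, which gives the factor `e^{as}`. For
`BMO`, bounding the integral over `E` by that over `B'` would lose `|B'|/|B| = e^{ds}`. Iterating a
stopping-ball decomposition, as for John–Nirenberg, gives instead (`MeanOscLE.setLIntegral_le`) `∫_E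
|f - f_{B'}| ≤ K N n |E| + N 2^{-n} |B'|` for every `n`, where `N` bounds the `BMO` seminorm; `n` of
order `ds` absorbs the exponential and leaves a factor linear in `s`.

Uniqueness is by duality: given a test function `ψ`, `duhamel` solves the adjoint equation with
right-hand side `ψ` for times `t ≥ 0`. That solution is only Lipschitz, so the weak formulation is
first extended to Lipschitz functions by mollification. Weak continuity then identifies `u(t)` with
`u₀ ∘ X t` at every single time (`IsWeakSolution.ae_eq_comp_flow`). -/

theorem LipschitzWith.norm_le_add_mul {E : Type*} [NormedAddCommGroup E] {v : E → E} {L : ℝ≥0}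
    (hv : LipschitzWith L v) (x : E) :
    ‖v x‖ ≤ L * ‖x‖ + ‖v 0‖ := by
  have := hv.dist_le_mul x 0
  rw [dist_eq_norm, dist_zero_right] at this
  linarith [norm_le_norm_add_norm_sub' (v x) (v 0)]

variable {E : Type*} [NormedAddCommGroup E] [NormedSpace ℝ E]

/-- Radial truncation of a vector to norm at most `M`. -/
noncomputable def radialTrunc (M : ℝ) (y : E) : E := (M / max M ‖y‖) • y

theorem radialTrunc_eq_self {M : ℝ} (hM : 0 < M) {y : E} (hy : ‖y‖ ≤ M) : radialTrunc M y = y := by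
  rw [radialTrunc, max_eq_left hy, div_self hM.ne', one_smul]

theorem norm_radialTrunc_le {M : ℝ} (hM : 0 < M) (y : E) : ‖radialTrunc M y‖ ≤ M := by
  have h : 0 < max M ‖y‖ := lt_max_of_lt_left hM
  rw [radialTrunc, norm_smul, Real.norm_of_nonneg (by positivity), div_mul_eq_mul_div,
    div_le_iff₀ h]
  gcongr
  exact le_max_right _ _

theorem norm_radialTrunc_le_norm {M : ℝ} (hM : 0 < M) (y : E) : ‖radialTrunc M y‖ ≤ ‖y‖ := by
  have h : 0 < max M ‖y‖ := lt_max_of_lt_left hM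
  rw [radialTrunc, norm_smul, Real.norm_of_nonneg (by positivity), div_mul_eq_mul_div,
    div_le_iff₀ h, mul_comm]
  gcongr
  exact le_max_left _ _

theorem lipschitzWith_radialTrunc {M : ℝ} (hM : 0 < M) :
    LipschitzWith 2 (radialTrunc M : E → E) := by
  refine LipschitzWith.of_dist_le_mul fun x y => ?_
  rw [dist_eq_norm, dist_eq_norm]
  have hx : 0 < max M ‖x‖ := lt_max_of_lt_left hM
  have hy : 0 < max M ‖y‖ := lt_max_of_lt_left hM
  have key : radialTrunc M x - radialTrunc M y =
      (M / max M ‖y‖) • (x - y) + (M / max M ‖x‖ - M / max M ‖y‖) • x := by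
    simp only [radialTrunc]; module
  have h1 : ‖(M / max M ‖y‖) • (x - y)‖ ≤ ‖x - y‖ := by
    rw [norm_smul, Real.norm_of_nonneg (by positivity)]
    refine mul_le_of_le_one_left (norm_nonneg _) ?_
    rw [div_le_one hy]; exact le_max_left _ _
  have h2 : ‖(M / max M ‖x‖ - M / max M ‖y‖) • x‖ ≤ ‖x - y‖ := by
    have e : M / max M ‖x‖ - M / max M ‖y‖ =
        (M / max M ‖y‖) * ((max M ‖y‖ - max M ‖x‖) * (max M ‖x‖)⁻¹) := by
      field_simp
    have h3 : |max M ‖y‖ - max M ‖x‖| ≤ ‖x - y‖ := by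
      refine (abs_max_sub_max_le_max _ _ _ _).trans ?_
      rw [sub_self, abs_zero, max_eq_right (abs_nonneg _), norm_sub_rev]
      exact abs_norm_sub_norm_le _ _
    rw [e, norm_smul, norm_mul, norm_mul, Real.norm_eq_abs (max M ‖y‖ - _),
      Real.norm_of_nonneg (by positivity), Real.norm_of_nonneg (by positivity : 0 ≤ (max M ‖x‖)⁻¹)]
    have h4 : (max M ‖x‖)⁻¹ * ‖x‖ ≤ 1 := by
      rw [inv_mul_le_iff₀ hx, mul_one]; exact le_max_right _ _
    have h5 : M / max M ‖y‖ ≤ 1 := by rw [div_le_one hy]; exact le_max_left _ _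
    calc M / max M ‖y‖ * (|max M ‖y‖ - max M ‖x‖| * (max M ‖x‖)⁻¹) * ‖x‖
        = M / max M ‖y‖ * (|max M ‖y‖ - max M ‖x‖| * ((max M ‖x‖)⁻¹ * ‖x‖)) := by ring
      _ ≤ 1 * (‖x - y‖ * 1) := by gcongr
      _ = ‖x - y‖ := by ring
  rw [key]
  calc _ ≤ _ := norm_add_le _ _
    _ ≤ ‖x - y‖ + ‖x - y‖ := add_le_add h1 h2
    _ = _ := by push_cast; ring

/-- A priori bound for trajectories of a field of at most linear growth, forward in time. -/
theorem norm_le_of_linear_growth {γ γ' : ℝ → E} {K ε T : ℝ}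
    (hK : 0 ≤ K) (hε : 0 ≤ ε)
    (hγ : ∀ t ∈ Icc (0 : ℝ) T, HasDerivWithinAt γ (γ' t) (Icc 0 T) t)
    (hγ' : ∀ t ∈ Icc (0 : ℝ) T, ‖γ' t‖ ≤ K * ‖γ t‖ + ε) {t : ℝ} (ht : t ∈ Icc 0 T) :
    ‖γ t‖ ≤ gronwallBound ‖γ 0‖ K ε T := by
  have h := norm_le_gronwallBound_of_norm_deriv_right_le (δ := ‖γ 0‖) (K := K) (ε := ε)
    (f := γ) (f' := γ') (a := 0) (b := T)
    (fun s hs => (hγ s hs).continuousWithinAt)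
    (fun s hs => (hγ s (Ico_subset_Icc_self hs)).mono_of_mem_nhdsWithin
      (Icc_mem_nhdsGE_of_mem hs)) le_rfl
    (fun s hs => hγ' s (Ico_subset_Icc_self hs)) t ht
  refine h.trans ?_
  rw [sub_zero]
  exact gronwallBound_mono (norm_nonneg _) hε hK ht.2

theorem exists_solution_Icc [CompleteSpace E] {v : E → E} {L : ℝ≥0} (hv : LipschitzWith L v)
    (x : E) (T : ℝ) (hT : 0 ≤ T) :
    ∃ γ : ℝ → E, γ 0 = x ∧ ∀ t ∈ Icc (-T) T, HasDerivWithinAt γ (v (γ t)) (Icc (-T) T) t := by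
  set R := gronwallBound ‖x‖ L ‖v 0‖ T with hR
  -- `R` comes from the growth bound `L‖y‖ + ‖v 0‖`, which truncation preserves, so it does not
  -- depend on `M`. Hence `M` may be chosen to dominate `v` on the ball of radius `R`, and the
  -- truncated trajectory never meets the truncation. The `1` only secures `M > 0`.
  set M := max 1 (L * R + ‖v 0‖) with hMdef
  have hM : 0 < M := lt_max_of_lt_left one_pos
  let w : E → E := fun y => radialTrunc M (v y)
  have hw : LipschitzWith (2 * L) w := (lipschitzWith_radialTrunc hM).comp hv
  have hwg : ∀ y, ‖w y‖ ≤ L * ‖y‖ + ‖v 0‖ := fun y =>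
    (norm_radialTrunc_le_norm hM _).trans (hv.norm_le_add_mul y)
  have h0 : (0 : ℝ) ∈ Icc (-T) T := ⟨by linarith, hT⟩
  have hP : IsPicardLindelof (fun _ => w) (⟨0, h0⟩ : Icc (-T) T) x (M.toNNReal * T.toNNReal) 0
      M.toNNReal (2 * L) := by
    refine IsPicardLindelof.of_time_independent (fun y _ => ?_) hw.lipschitzOnWith ?_
    · rw [Real.coe_toNNReal _ hM.le]; exact norm_radialTrunc_le hM _
    · simp [Real.coe_toNNReal _ hM.le, Real.coe_toNNReal _ hT]
  obtain ⟨γ, hγ0, hγ⟩ := hP.exists_eq_forall_mem_Icc_hasDerivWithinAt₀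
  simp only at hγ0
  have hfw : ∀ t ∈ Icc (0 : ℝ) T, ‖γ t‖ ≤ R := by
    intro t ht
    have := norm_le_of_linear_growth (γ := γ) (γ' := fun t => w (γ t)) L.2 (norm_nonneg (v 0))
      (fun s hs => (hγ s ⟨by linarith [hs.1], hs.2⟩).mono (Icc_subset_Icc_left (by linarith)))
      (fun s _ => hwg _) ht
    rwa [hγ0] at this
  have hbw : ∀ t ∈ Icc (0 : ℝ) T, ‖γ (-t)‖ ≤ R := by
    intro t ht
    have := norm_le_of_linear_growth (γ := fun s => γ (-s)) (γ' := fun t => -w (γ (-t)))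
      L.2 (norm_nonneg (v 0))
      (fun s hs => by
        have h1 := hγ (-s) ⟨by linarith [hs.2], by linarith [hs.1]⟩
        have h2 := h1.scomp (h := fun s : ℝ => -s) (s := Icc 0 T) s
          ((hasDerivAt_neg s).hasDerivWithinAt)
          (fun r hr => ⟨by linarith [hr.2], by linarith [hr.1]⟩)
        simpa [Function.comp_def] using h2)
      (fun s _ => by rw [norm_neg]; exact hwg _) ht
    simpa [hγ0] using this
  refine ⟨γ, hγ0, fun t ht => ?_⟩
  have hb : ‖γ t‖ ≤ R := by
    rcases le_total 0 t with h | h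
    · exact hfw t ⟨h, ht.2⟩
    · simpa using hbw (-t) ⟨by linarith, by linarith [ht.1]⟩
  have hwv : w (γ t) = v (γ t) := by
    refine radialTrunc_eq_self hM ((hv.norm_le_add_mul _).trans (le_max_of_le_right ?_))
    gcongr
  rw [← hwv]
  exact hγ t ht

/-- `X` is the (global) flow of the autonomous vector field `v`. -/
structure IsFlow (v : E → E) (X : ℝ → E → E) : Prop where
  map_zero : ∀ x, X 0 x = x
  hasDerivAt : ∀ t x, HasDerivAt (fun s => X s x) (v (X t x)) t

theorem exists_isFlow [CompleteSpace E] {v : E → E} {L : ℝ≥0} (hv : LipschitzWith L v) :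
    ∃ X : ℝ → E → E, IsFlow v X := by
  have h := fun (x : E) (n : ℕ) => exists_solution_Icc hv x (n + 1) (by positivity)
  choose γ hγ0 hγ using h
  have hD : ∀ (x : E) (n : ℕ), ∀ t ∈ Ioo (-(n + 1 : ℝ)) (n + 1), HasDerivAt (γ x n) (v (γ x n t)) t :=
    fun x n t ht => (hγ x n t (Ioo_subset_Icc_self ht)).hasDerivAt (Icc_mem_nhds ht.1 ht.2)
  have hu : ∀ x (m n : ℕ), m ≤ n → EqOn (γ x m) (γ x n) (Ioo (-(m + 1 : ℝ)) (m + 1)) := by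
    intro x m n hmn
    have hmn' : (m : ℝ) ≤ n := by exact_mod_cast hmn
    have hm : (0 : ℝ) ≤ m := by positivity
    refine ODE_solution_unique_of_mem_Ioo (v := fun _ => v) (s := fun _ => univ) (K := L) (t₀ := 0)
      (fun _ _ => hv.lipschitzOnWith) ⟨by linarith, by linarith⟩
      (fun t ht => ⟨hD x m t ht, trivial⟩)
      (fun t ht => ⟨hD x n t ⟨by linarith [ht.1], by linarith [ht.2]⟩, trivial⟩) ?_
    rw [hγ0, hγ0]
  refine ⟨fun t x => γ x ⌈|t|⌉₊ t, fun x => by simp [hγ0], fun t x => ?_⟩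
  -- The index `⌈|s|⌉₊` jumps with `s`, but for `|s - t| < 1` it is at most `n`, so near `t` the
  -- glued curve is the single solution `γ x n`.
  set n := ⌈|t|⌉₊ + 1
  have hn : |t| + 1 ≤ n := by
    have := Nat.le_ceil |t|
    simp only [n]; push_cast; linarith
  have hev : (fun s => γ x ⌈|s|⌉₊ s) =ᶠ[nhds t] γ x n := by
    have : Metric.ball t 1 ∈ nhds t := Metric.ball_mem_nhds _ one_pos
    filter_upwards [this] with s hs
    rw [Metric.mem_ball, Real.dist_eq] at hs
    have h1 : |s| ≤ n := by
      have := abs_sub_abs_le_abs_sub s t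
      linarith
    refine hu x _ _ (Nat.ceil_le.2 h1) ?_
    have h2 := Nat.le_ceil |s|
    rw [mem_Ioo, ← abs_lt]; linarith
  have hd := hD x n t (by rw [mem_Ioo, ← abs_lt]; linarith)
  have := hd.congr_of_eventuallyEq hev
  rwa [← hev.self_of_nhds] at this

namespace IsFlow

variable {v : E → E} {X : ℝ → E → E} {L : ℝ≥0}

theorem eq_of_hasDerivAt (hX : IsFlow v X) (hv : LipschitzWith L v) {γ : ℝ → E}
    (hγ : ∀ t, HasDerivAt γ (v (γ t)) t) (t : ℝ) : γ t = X t (γ 0) :=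
  congrFun (ODE_solution_unique_univ (v := fun _ => v) (s := fun _ => univ) (K := L) (t₀ := 0)
    (f := γ) (g := fun t => X t (γ 0)) (fun _ => hv.lipschitzOnWith) (fun t => ⟨hγ t, trivial⟩)
    (fun t => ⟨hX.hasDerivAt t _, trivial⟩) (hX.map_zero _).symm) t

theorem map_add (hX : IsFlow v X) (hv : LipschitzWith L v) (s t : ℝ) (x : E) :
    X (s + t) x = X s (X t x) := by
  have := hX.eq_of_hasDerivAt hv (γ := fun s => X (s + t) x)
    (fun s => by simpa using (hX.hasDerivAt (s + t) x).comp_add_const s t) s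
  simpa using this

theorem map_neg_map (hX : IsFlow v X) (hv : LipschitzWith L v) (t : ℝ) (x : E) :
    X (-t) (X t x) = x := by
  rw [← hX.map_add hv, neg_add_cancel, hX.map_zero]

theorem map_map_neg (hX : IsFlow v X) (hv : LipschitzWith L v) (t : ℝ) (x : E) :
    X t (X (-t) x) = x := by
  rw [← hX.map_add hv, add_neg_cancel, hX.map_zero]

theorem neg (hX : IsFlow v X) : IsFlow (fun x => -v x) (fun t => X (-t)) where
  map_zero x := by simpa using hX.map_zero x
  hasDerivAt t x := by
    have := (hX.hasDerivAt (-t) x).scomp t (hasDerivAt_neg t)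
    simpa [Function.comp_def] using this

theorem dist_le_of_nonneg (hX : IsFlow v X) (hv : LipschitzWith L v) {t : ℝ} (ht : 0 ≤ t)
    (x y : E) : dist (X t x) (X t y) ≤ Real.exp (L * t) * dist x y := by
  have := dist_le_of_trajectories_ODE (v := fun _ => v) (K := L) (f := fun s => X s x)
    (g := fun s => X s y) (a := 0) (b := t) (δ := dist x y) (fun _ => hv)
    (fun s _ => (hX.hasDerivAt s x).continuousAt.continuousWithinAt)
    (fun s _ => (hX.hasDerivAt s x).hasDerivWithinAt)
    (fun s _ => (hX.hasDerivAt s y).continuousAt.continuousWithinAt)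
    (fun s _ => (hX.hasDerivAt s y).hasDerivWithinAt)
    (by rw [hX.map_zero, hX.map_zero]) t ⟨ht, le_rfl⟩
  rw [sub_zero] at this
  rwa [mul_comm]

theorem dist_le (hX : IsFlow v X) (hv : LipschitzWith L v) (t : ℝ) (x y : E) :
    dist (X t x) (X t y) ≤ Real.exp (L * |t|) * dist x y := by
  rcases le_total 0 t with h | h
  · rw [abs_of_nonneg h]; exact hX.dist_le_of_nonneg hv h x y
  · have hv' : LipschitzWith L (fun x => -v x) := hv.neg
    have := hX.neg.dist_le_of_nonneg hv' (t := -t) (by linarith) x y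
    rwa [neg_neg, ← abs_of_nonpos h] at this

theorem lipschitzWith (hX : IsFlow v X) (hv : LipschitzWith L v) (t : ℝ) :
    LipschitzWith (Real.exp (L * |t|)).toNNReal (X t) :=
  LipschitzWith.of_dist_le_mul fun x y => by
    rw [Real.coe_toNNReal _ (Real.exp_pos _).le]; exact hX.dist_le hv t x y

/-- The spatial Lipschitz constants are locally uniform in time, which upgrades separate continuity
to joint continuity. -/
theorem continuous_uncurry (hX : IsFlow v X) (hv : LipschitzWith L v) :
    Continuous fun z : ℝ × E => X z.1 z.2 := by
  rw [continuous_iff_continuousAt]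
  rintro ⟨t, x⟩
  have hc : ContinuousOn (fun z : ℝ × E => X z.1 z.2) (Ioo (t - 1) (t + 1) ×ˢ univ) := by
    refine continuousOn_prod_of_continuousOn_lipschitzOnWith'
      (K := (Real.exp (L * (|t| + 1))).toNNReal) _ (fun s hs => ?_) (fun y _ s _ =>
        (hX.hasDerivAt s y).continuousAt.continuousWithinAt)
    refine ((hX.lipschitzWith hv s).weaken ?_).lipschitzOnWith
    gcongr
    have : |s - t| ≤ 1 := abs_le.2 ⟨by linarith [hs.1], by linarith [hs.2]⟩
    have := abs_sub_abs_le_abs_sub s t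
    linarith
  exact hc.continuousAt (prod_mem_nhds (Ioo_mem_nhds (by linarith) (by linarith)) Filter.univ_mem)

/-- The time-`t` map of a flow as a homeomorphism. -/
@[simps]
noncomputable def homeomorph (hX : IsFlow v X) (hv : LipschitzWith L v) (t : ℝ) : E ≃ₜ E where
  toFun := X t
  invFun := X (-t)
  left_inv := hX.map_neg_map hv t
  right_inv := hX.map_map_neg hv t
  continuous_toFun := (hX.lipschitzWith hv t).continuous
  continuous_invFun := (hX.lipschitzWith hv (-t)).continuous

end IsFlow

end Flow

/-! ### Divergence-free flows preserve volume. -/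

section MeasurePreserving

open Filter Topology

theorem lipschitzWith_lipNorm {d : ℕ} {v : Eucl d → Eucl d} (h : ∃ K : ℝ≥0, LipschitzWith K v) :
    LipschitzWith (lipNorm v) v := by
  refine LipschitzWith.of_dist_le_mul fun x y => ?_
  rcases (dist_nonneg (x := x) (y := y)).eq_or_lt with h0 | h0
  · obtain ⟨K, hK⟩ := h
    have := hK.dist_le_mul x y
    rw [← h0, mul_zero] at this ⊢
    exact this
  · rw [← div_le_iff₀ h0]
    have : (dist (v x) (v y) / dist x y).toNNReal ≤ lipNorm v := by
      refine le_csInf h fun K hK => ?_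
      rw [Real.toNNReal_le_iff_le_coe, div_le_iff₀ h0]
      exact hK.dist_le_mul x y
    rwa [Real.toNNReal_le_iff_le_coe] at this

/-- Regular measures on a proper metric space are determined by the integrals of
compactly supported Lipschitz functions. -/
theorem MeasureTheory.Measure.ext_of_integral_eq_on_lipschitz {X : Type*} [MetricSpace X]
    [ProperSpace X] [MeasurableSpace X] [BorelSpace X] {μ ν : Measure X} [μ.Regular] [ν.Regular]
    (h : ∀ (f : X → ℝ) (C : ℝ≥0), LipschitzWith C f → HasCompactSupport f →
      ∫ x, f x ∂μ = ∫ x, f x ∂ν) : μ = ν := by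
  -- The indicator of a compact set is a limit of Lipschitz functions supported in one compact set;
  -- inner and outer regularity then pass to open and to all sets.
  have key : ∀ K : Set X, IsCompact K → μ K = ν K := by
    intro K hK
    have hpos : ∀ n : ℕ, (0 : ℝ) < 1 / ((n : ℝ) + 1) := fun n => by positivity
    let f : ℕ → X → ℝ := fun n x => thickenedIndicator (hpos n) K x
    have hsupp : ∀ n x, x ∉ Metric.cthickening 1 K → f n x = 0 := by
      intro n x hx
      have : x ∉ Metric.thickening (1 / ((n : ℝ) + 1)) K := fun hx' => hx <|
        Metric.thickening_subset_cthickening_of_le (by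
          rw [div_le_one (by positivity)]; linarith [n.cast_nonneg (α := ℝ)]) _ hx'
      simp only [f, thickenedIndicator_zero (hpos n) K this, NNReal.coe_zero]
    have hcs : ∀ n, HasCompactSupport (f n) := fun n =>
      HasCompactSupport.intro hK.cthickening (hsupp n)
    have hlip : ∀ n : ℕ, LipschitzWith (1 / ((n : ℝ) + 1)).toNNReal⁻¹ (f n) := fun n =>
      LipschitzWith.of_dist_le_mul fun x y =>
        (lipschitzWith_thickenedIndicator (hpos n) K).dist_le_mul x y
    have lim : ∀ (ρ : Measure X) [ρ.Regular],
        Tendsto (fun n => ∫ x, f n x ∂ρ) atTop (𝓝 (∫ x, K.indicator 1 x ∂ρ)) := by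
      intro ρ _
      refine tendsto_integral_of_dominated_convergence
        ((Metric.cthickening 1 K).indicator 1) (fun n => (hlip n).continuous.aestronglyMeasurable)
        ?_ (fun n => .of_forall fun x => ?_) (.of_forall fun x => ?_)
      · exact (integrable_indicator_iff Metric.isClosed_cthickening.measurableSet).2
          (integrableOn_const hK.cthickening.measure_lt_top.ne)
      · by_cases hx : x ∈ Metric.cthickening 1 K
        · rw [indicator_of_mem hx, Real.norm_of_nonneg (by simp [f])]
          exact NNReal.coe_le_one.2 (thickenedIndicator_le_one (hpos n) K x)
        · rw [hsupp n x hx, indicator_of_notMem hx, norm_zero]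
      · have h1 := thickenedIndicator_tendsto_indicator_closure hpos
          tendsto_one_div_add_atTop_nhds_zero_nat K
        rw [tendsto_pi_nhds] at h1
        have h2 := (NNReal.continuous_coe.tendsto _).comp (h1 x)
        rw [hK.isClosed.closure_eq] at h2
        have h3 : K.indicator (1 : X → ℝ) x = ((K.indicator (fun _ => (1 : ℝ≥0)) x : ℝ≥0) : ℝ) := by
          by_cases hx : x ∈ K <;> simp [hx]
        rw [h3]
        exact h2
    have h1 : Tendsto (fun n => ∫ x, f n x ∂ν) atTop (𝓝 (∫ x, K.indicator 1 x ∂μ)) := by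
      simpa only [h _ _ (hlip _) (hcs _)] using lim μ
    have h2 := tendsto_nhds_unique h1 (lim ν)
    rw [integral_indicator_one hK.measurableSet, integral_indicator_one hK.measurableSet] at h2
    exact (measureReal_eq_measureReal_iff hK.measure_lt_top.ne hK.measure_lt_top.ne).1 h2
  apply Measure.OuterRegular.ext_isOpen
  intro U hU
  exact Measure.InnerRegularWRT.eq_of_innerRegularWRT_of_forall_eq Measure.Regular.innerRegular
    Measure.Regular.innerRegular key hU


variable {d : ℕ} {v : Eucl d → Eucl d} {L : ℝ≥0} {X : ℝ → Eucl d → Eucl d}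

theorem lineDeriv_eq_zero_of_notMem_tsupport {F : Type*} [NormedAddCommGroup F] [NormedSpace ℝ F]
    {φ : F → ℝ} {x : F} (hx : x ∉ tsupport φ) (e : F) : lineDeriv ℝ φ x e = 0 := by
  have h : φ =ᶠ[𝓝 x] 0 := notMem_tsupport_iff_eventuallyEq.1 hx
  rw [h.lineDeriv_eq, lineDeriv]
  simp

theorem LipschitzWith.ae_fderiv_apply_eq_sum {φ : Eucl d → ℝ} {C : ℝ≥0} (hφ : LipschitzWith C φ)
    (v : Eucl d → Eucl d) :
    ∀ᵐ x : Eucl d, fderiv ℝ φ x (v x) =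
      ∑ i : Fin d, lineDeriv ℝ φ x (EuclideanSpace.single i 1) * v x i := by
  filter_upwards [hφ.ae_differentiableAt] with x hx
  have h : v x = ∑ i : Fin d, v x i • EuclideanSpace.single i (1 : ℝ) := by
    have := (EuclideanSpace.basisFun (Fin d) ℝ).sum_repr (v x)
    simpa using this.symm
  conv_lhs => rw [h, map_sum]
  refine Finset.sum_congr rfl fun i _ => ?_
  rw [map_smul, hx.lineDeriv_eq_fderiv, smul_eq_mul, mul_comm]

/-- A divergence-free Lipschitz field is weakly divergence free against compactly supported
Lipschitz functions. -/
theorem IsLipschitzDivFree.integral_fderiv_apply_eq_zero (hv : IsLipschitzDivFree v)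
    {φ : Eucl d → ℝ} {C : ℝ≥0} (hφ : LipschitzWith C φ) (hc : HasCompactSupport φ) :
    ∫ x, fderiv ℝ φ x (v x) = 0 := by
  have hvL := lipschitzWith_lipNorm hv.lipschitz
  have hvi : ∀ i : Fin d, LipschitzWith (lipNorm v) (fun x => v x i) := fun i =>
    LipschitzWith.of_dist_le_mul fun x y => (by
      rw [Real.dist_eq, dist_eq_norm]
      exact PiLp.norm_apply_le (v x - v y) i : dist (v x i) (v y i) ≤ dist (v x) (v y)).trans
        (hvL.dist_le_mul x y)
  have hgradφ : ∀ i : Fin d, Integrable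
      (fun x => lineDeriv ℝ φ x (EuclideanSpace.single i 1) * v x i) := by
    intro i
    have h1 : IntegrableOn (fun x => lineDeriv ℝ φ x (EuclideanSpace.single i 1) * v x i)
        (tsupport φ) :=
      ((hφ.locallyIntegrable_lineDeriv (μ := volume) _).integrableOn_isCompact hc).mul_continuousOn
        (hvi i).continuous.continuousOn hc
    refine (integrableOn_iff_integrable_of_support_subset fun x hx => ?_).1 h1
    by_contra h
    exact hx (by simp only [lineDeriv_eq_zero_of_notMem_tsupport h, zero_mul])
  have hdivφ : ∀ i : Fin d, Integrable
      (fun x => lineDeriv ℝ (fun y => v y i) x (EuclideanSpace.single i 1) * φ x) := fun i =>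
    (hφ.continuous.integrable_of_hasCompactSupport hc).bdd_mul
      ((hvi i).memLp_lineDeriv _).aestronglyMeasurable
      (.of_forall fun x => norm_lineDeriv_le_of_lipschitz ℝ (hvi i))
  rw [integral_congr_ae (hφ.ae_fderiv_apply_eq_sum v), integral_finsetSum _ fun i _ => hgradφ i]
  -- Coordinatewise integration by parts between Lipschitz functions: `∫ ∇φ · v = -∫ φ ∇ · v`.
  have hparts : ∀ i : Fin d,
      ∫ x, lineDeriv ℝ φ x (EuclideanSpace.single i 1) * v x i =
        -∫ x, lineDeriv ℝ (fun y => v y i) x (EuclideanSpace.single i 1) * φ x := by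
    intro i
    rw [(hvi i).integral_lineDeriv_mul_eq hφ hc]
    simp only [lineDeriv_neg, neg_mul, integral_neg, neg_neg]
  rw [Finset.sum_congr rfl fun i _ => hparts i, Finset.sum_neg_distrib,
    ← integral_finsetSum _ fun i _ => hdivφ i, neg_eq_zero]
  refine integral_eq_zero_of_ae ?_
  filter_upwards [hvL.ae_differentiableAt, hv.div_eq_zero] with x hx hdiv
  rw [← Finset.sum_mul]
  have : ∀ i : Fin d, lineDeriv ℝ (fun y => v y i) x (EuclideanSpace.single i 1) =
      fderiv ℝ v x (EuclideanSpace.single i 1) i := by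
    intro i
    have h := ((EuclideanSpace.proj (𝕜 := ℝ) i : Eucl d →L[ℝ] ℝ).hasFDerivAt.comp x
      hx.hasFDerivAt).hasLineDerivAt (EuclideanSpace.single i 1)
    exact h.lineDeriv
  simp only [this, hdiv, zero_mul, Pi.zero_apply]

namespace IsFlow

theorem hasDerivAt_comp {φ : Eucl d → ℝ} (hX : IsFlow v X) {x : Eucl d}
    (hφ : DifferentiableAt ℝ φ x) :
    HasDerivAt (fun s => φ (X s x)) (fderiv ℝ φ x (v x)) 0 := by
  have h1 := hX.hasDerivAt 0 x
  have h2 : HasFDerivAt φ (fderiv ℝ φ x) (X 0 x) := by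
    rw [hX.map_zero]; exact hφ.hasFDerivAt
  have := h2.comp_hasDerivAt 0 h1
  rwa [hX.map_zero] at this

/-- Differentiation under the integral gives `∫ dφ(v)`, which vanishes because `v` is divergence
free. The difference quotients are dominated by a constant on the compact set of points whose
trajectory meets the support. -/
theorem hasDerivAt_integral_comp (hX : IsFlow v X) (hv : IsLipschitzDivFree v)
    {φ : Eucl d → ℝ} {C : ℝ≥0} (hφ : LipschitzWith C φ) (hc : HasCompactSupport φ) :
    HasDerivAt (fun s => ∫ x, φ (X s x)) 0 0 := by
  have hvL := lipschitzWith_lipNorm hv.lipschitz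
  have hXc := hX.continuous_uncurry hvL
  set I : Set ℝ := Icc (-1) 1
  have hI : IsCompact I := isCompact_Icc
  -- points that visit the support of `φ` for times in `I`
  set K : Set (Eucl d) := (fun z : ℝ × Eucl d => X z.1 z.2) '' (I ×ˢ tsupport φ)
  have hK : IsCompact K := (hI.prod hc).image hXc
  have hKz : ∀ x ∉ K, ∀ s ∈ I, φ (X s x) = 0 := by
    intro x hx s hs
    by_contra h
    refine hx ⟨(-s, X s x), ⟨⟨by linarith [hs.2], by linarith [hs.1]⟩, subset_tsupport _ h⟩, ?_⟩
    exact hX.map_neg_map hvL s x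
  obtain ⟨M, hM⟩ : ∃ M, ∀ z ∈ I ×ˢ K, ‖v (X z.1 z.2)‖ ≤ M :=
    (hI.prod hK).exists_bound_of_continuousOn (hvL.continuous.comp hXc).continuousOn
  have hlipK : ∀ x ∈ K, LipschitzOnWith M.toNNReal (fun s => X s x) I := by
    intro x hx
    refine (convex_Icc (-1 : ℝ) 1).lipschitzOnWith_of_nnnorm_hasDerivWithin_le
      (fun s _ => (hX.hasDerivAt s x).hasDerivWithinAt) fun s hs => ?_
    rw [← NNReal.coe_le_coe]
    exact (hM (s, x) ⟨hs, hx⟩).trans (Real.le_coe_toNNReal M)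
  have hmem : I ∈ 𝓝 (0 : ℝ) := Icc_mem_nhds (by norm_num) (by norm_num)
  have hcont : ∀ s, Continuous fun x => φ (X s x) := fun s =>
    hφ.continuous.comp (hX.lipschitzWith hvL s).continuous
  have key := hasDerivAt_integral_of_dominated_loc_of_lip (μ := volume)
    (F := fun s x => φ (X s x)) (F' := fun x => fderiv ℝ φ x (v x)) (x₀ := (0 : ℝ))
    (bound := K.indicator fun _ => (C : ℝ) * M.toNNReal) hmem
    (.of_forall fun s => (hcont s).aestronglyMeasurable)
    (by simpa only [hX.map_zero] using hφ.continuous.integrable_of_hasCompactSupport hc)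
    (by
      refine AEStronglyMeasurable.congr ?_
        (EventuallyEq.symm (hφ.ae_fderiv_apply_eq_sum v))
      refine Finset.aestronglyMeasurable_fun_sum _ fun i _ => ?_
      exact (hφ.memLp_lineDeriv _).aestronglyMeasurable.mul
        ((EuclideanSpace.proj (𝕜 := ℝ) i : Eucl d →L[ℝ] ℝ).continuous.comp
          hvL.continuous).aestronglyMeasurable)
    (.of_forall fun x => by
      by_cases hx : x ∈ K
      · rw [indicator_of_mem hx]
        have := hφ.comp_lipschitzOnWith (hlipK x hx)
        refine this.weaken ?_
        rw [← NNReal.coe_le_coe, Real.coe_nnabs]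
        exact le_abs_self _
      · refine LipschitzOnWith.of_dist_le_mul fun s hs t ht => ?_
        simp only [hKz x hx s hs, hKz x hx t ht, dist_self]
        positivity)
    ((integrable_indicator_iff hK.measurableSet).2
      (integrableOn_const hK.measure_lt_top.ne))
    (by
      filter_upwards [hφ.ae_differentiableAt] with x hx
      exact hX.hasDerivAt_comp hx)
  simpa only [hv.integral_fderiv_apply_eq_zero hφ hc] using key.2

/-- By the group law, the derivative at time `t` is the derivative at time `0` for `φ ∘ X t`. Even
for smooth `φ` this composite is in general only Lipschitz, which is why the test class is
Lipschitz. -/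
theorem integral_comp_lipschitz (hX : IsFlow v X) (hv : IsLipschitzDivFree v)
    {φ : Eucl d → ℝ} {C : ℝ≥0} (hφ : LipschitzWith C φ) (hc : HasCompactSupport φ) (t : ℝ) :
    ∫ x, φ (X t x) = ∫ x, φ x := by
  have hvL := lipschitzWith_lipNorm hv.lipschitz
  have hd : ∀ t, HasDerivAt (fun s => ∫ x, φ (X s x)) 0 t := by
    intro t
    have h := hX.hasDerivAt_integral_comp hv (hφ.comp (hX.lipschitzWith hvL t))
      (hc.comp_homeomorph (hX.homeomorph hvL t))
    have h' : HasDerivAt (fun s => ∫ x, (φ ∘ X t) (X s x)) 0 (t + -t) := by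
      rwa [add_neg_cancel]
    have := h'.comp_add_const t (-t)
    refine this.congr_of_eventuallyEq (.of_forall fun s => ?_)
    simp only [Function.comp_apply, ← hX.map_add hvL, add_neg_cancel_comm_assoc]
  have := is_const_of_deriv_eq_zero (fun t => (hd t).differentiableAt) (fun t => (hd t).deriv) t 0
  simpa only [hX.map_zero] using this

/-- The flow of a divergence-free Lipschitz field preserves volume. -/
theorem measurePreserving (hX : IsFlow v X) (hv : IsLipschitzDivFree v) (t : ℝ) :
    MeasurePreserving (X t) := by
  have hvL := lipschitzWith_lipNorm hv.lipschitz
  have hm : Measurable (X t) := (hX.lipschitzWith hvL t).continuous.measurable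
  refine ⟨hm, ?_⟩
  have : (Measure.map (X t) (volume : Measure (Eucl d))).Regular :=
    Measure.Regular.map (hX.homeomorph hvL t)
  refine Measure.ext_of_integral_eq_on_lipschitz fun f C hf hc => ?_
  rw [integral_map hm.aemeasurable hf.continuous.aestronglyMeasurable]
  exact hX.integral_comp_lipschitz hv hf hc t

end IsFlow

end MeasurePreserving

/-! ### Approximating Lipschitz functions by test functions. -/

section Mollification

open Filter Topology
open scoped Convolution

variable {F : Type*} [NormedAddCommGroup F] [NormedSpace ℝ F] [FiniteDimensional ℝ F]
  [MeasurableSpace F] [BorelSpace F] {μ : Measure F} [μ.IsAddHaarMeasure]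

/-- Mollifying averages translates against a probability density, so the constant `C` survives
unchanged and bounds all derivatives of the approximants. -/
theorem ContDiffBump.lipschitzWith_convolution (ρ : ContDiffBump (0 : F)) {φ : F → ℝ} {C : ℝ≥0}
    (hφ : LipschitzWith C φ) :
    LipschitzWith C (ρ.normed μ ⋆[ContinuousLinearMap.lsmul ℝ ℝ, μ] φ) := by
  refine LipschitzWith.of_dist_le_mul fun x y => ?_
  have hi : ∀ z, Integrable (fun t => ρ.normed μ t • φ (z - t)) μ := fun z =>
    Continuous.integrable_of_hasCompactSupport
      (ρ.continuous_normed.smul (hφ.continuous.comp (by fun_prop)))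
      ρ.hasCompactSupport_normed.smul_right
  simp only [convolution_def, ContinuousLinearMap.lsmul_apply]
  rw [dist_eq_norm, ← integral_sub (hi x) (hi y)]
  calc ‖∫ t, (ρ.normed μ t • φ (x - t) - ρ.normed μ t • φ (y - t)) ∂μ‖
      ≤ ∫ t, ρ.normed μ t * (C * dist x y) ∂μ := by
        refine norm_integral_le_of_norm_le (ρ.integrable_normed.mul_const _)
          (.of_forall fun t => ?_)
        rw [← smul_sub, norm_smul, Real.norm_of_nonneg (ρ.nonneg_normed t)]
        refine mul_le_mul_of_nonneg_left ?_ (ρ.nonneg_normed t)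
        rw [← dist_eq_norm]
        simpa using hφ.dist_le_mul (x - t) (y - t)
    _ = C * dist x y := by rw [integral_mul_const, ρ.integral_normed, one_mul]

/-- Putting the derivative on `φ` instead of the kernel turns convergence of derivatives into
Lebesgue differentiation of `lineDeriv ℝ φ`. -/
theorem ContDiffBump.hasLineDerivAt_convolution (ρ : ContDiffBump (0 : F)) {φ : F → ℝ} {C : ℝ≥0}
    (hφ : LipschitzWith C φ) (z e : F) :
    HasLineDerivAt ℝ (ρ.normed μ ⋆[ContinuousLinearMap.lsmul ℝ ℝ, μ] φ)
      ((ρ.normed μ ⋆[ContinuousLinearMap.lsmul ℝ ℝ, μ] fun y => lineDeriv ℝ φ y e) z) z e := by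
  have hi : ∀ z, Integrable (fun t => ρ.normed μ t * φ (z - t)) μ := fun z =>
    Continuous.integrable_of_hasCompactSupport
      (ρ.continuous_normed.smul (hφ.continuous.comp (by fun_prop)))
      ρ.hasCompactSupport_normed.smul_right
  have key := hasDerivAt_integral_of_dominated_loc_of_lip (μ := μ) (𝕜 := ℝ)
    (F := fun (s : ℝ) t => ρ.normed μ t * φ (z + s • e - t))
    (F' := fun t => ρ.normed μ t * lineDeriv ℝ φ (z - t) e) (x₀ := (0 : ℝ))
    (bound := fun t => ρ.normed μ t * (C * ‖e‖)) (s := univ) univ_mem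
    (.of_forall fun s => (hi _).aestronglyMeasurable) (hi _)
    (by
      refine ρ.continuous_normed.aestronglyMeasurable.mul ?_
      exact (hφ.memLp_lineDeriv (μ := μ) e).aestronglyMeasurable.comp_quasiMeasurePreserving
        (quasiMeasurePreserving_sub_left_of_right_invariant μ z))
    (.of_forall fun t => by
      refine LipschitzOnWith.of_dist_le_mul fun s _ r _ => ?_
      rw [Real.coe_nnabs, abs_of_nonneg (mul_nonneg (ρ.nonneg_normed t) (by positivity)),
        dist_eq_norm, ← mul_sub, norm_mul, Real.norm_of_nonneg (ρ.nonneg_normed t), mul_assoc]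
      refine mul_le_mul_of_nonneg_left ?_ (ρ.nonneg_normed t)
      rw [← dist_eq_norm]
      refine (hφ.dist_le_mul _ _).trans_eq ?_
      have : z + s • e - t - (z + r • e - t) = (s - r) • e := by module
      rw [dist_eq_norm, this, norm_smul, ← dist_eq_norm]
      ring)
    (ρ.integrable_normed.mul_const _)
    (by
      have := (quasiMeasurePreserving_sub_left_of_right_invariant μ z).ae
        (hφ.ae_lineDifferentiableAt (μ := μ) e)
      filter_upwards [this] with t ht
      have h := (ht.hasLineDerivAt).const_mul (ρ.normed μ t)
      refine HasDerivAt.congr_of_eventuallyEq h (.of_forall fun s => ?_)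
      simp only [sub_add_eq_add_sub])
  exact key.2

/-- A compactly supported Lipschitz function is approximated by test functions with uniformly
bounded supports and derivatives, the derivatives converging almost everywhere. -/
theorem LipschitzWith.exists_testFunction_seq {φ : F → ℝ} {C : ℝ≥0}
    (hφ : LipschitzWith C φ) (hc : HasCompactSupport φ) :
    ∃ (f : ℕ → F → ℝ) (K : Set F), IsCompact K ∧ (∀ n, IsTestFunction (f n)) ∧
      (∀ n, tsupport (f n) ⊆ K) ∧ (∀ n z, ‖fderiv ℝ (f n) z‖ ≤ C) ∧
      ∀ᵐ z ∂μ, ∀ e, Tendsto (fun n => fderiv ℝ (f n) z e) atTop (𝓝 (fderiv ℝ φ z e)) := by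
  have : ProperSpace F := FiniteDimensional.proper ℝ F
  have hpos : ∀ n : ℕ, (0 : ℝ) < 1 / ((n : ℝ) + 1) := fun n => by positivity
  let ρ : ℕ → ContDiffBump (0 : F) := fun n =>
    ⟨1 / ((n : ℝ) + 1) / 2, 1 / ((n : ℝ) + 1), half_pos (hpos n), half_lt_self (hpos n)⟩
  let f : ℕ → F → ℝ := fun n => (ρ n).normed μ ⋆[ContinuousLinearMap.lsmul ℝ ℝ, μ] φ
  have hsupp : ∀ n, tsupport (f n) ⊆ Metric.cthickening 1 (tsupport φ) := by
    intro n
    refine closure_minimal (fun x hx => ?_) Metric.isClosed_cthickening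
    obtain ⟨a, ha, b, hb, rfl⟩ := support_convolution_subset (ContinuousLinearMap.lsmul ℝ ℝ) hx
    rw [(ρ n).support_normed_eq, mem_ball_zero_iff] at ha
    refine Metric.mem_cthickening_of_dist_le _ b _ _ (subset_tsupport _ hb) ?_
    simp only [dist_add_self_left]
    refine ha.le.trans ?_
    change 1 / ((n : ℝ) + 1) ≤ 1
    rw [div_le_one (by positivity)]; linarith [n.cast_nonneg (α := ℝ)]
  have hK : IsCompact (Metric.cthickening 1 (tsupport φ)) := IsCompact.cthickening hc
  have hsm : ∀ n, ContDiff ℝ ∞ (f n) := fun n =>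
    (ρ n).hasCompactSupport_normed.contDiff_convolution_left _ (ρ n).contDiff_normed
      hφ.continuous.locallyIntegrable
  have hlip : ∀ n, LipschitzWith C (f n) := fun n => (ρ n).lipschitzWith_convolution hφ
  refine ⟨f, _, hK, fun n => ⟨hsm n, HasCompactSupport.of_support_subset_isCompact hK
    ((subset_tsupport _).trans (hsupp n))⟩, hsupp,
    fun n z => norm_fderiv_le_of_lipschitz ℝ (hlip n), ?_⟩
  let b := Module.finBasis ℝ F
  have hlim : ∀ i, ∀ᵐ z ∂μ, Tendsto
      (fun n => ((ρ n).normed μ ⋆[ContinuousLinearMap.lsmul ℝ ℝ, μ]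
        fun y => lineDeriv ℝ φ y (b i)) z) atTop (𝓝 (lineDeriv ℝ φ z (b i))) := fun i =>
    -- `2` is the fixed ratio of outer to inner bump radius.
    ContDiffBump.ae_convolution_tendsto_right_of_locallyIntegrable (K := 2)
      tendsto_one_div_add_atTop_nhds_zero_nat
      (.of_forall fun n => by simp only [ρ]; linarith)
      (hφ.locallyIntegrable_lineDeriv (b i))
  filter_upwards [hφ.ae_differentiableAt (μ := μ), ae_all_iff.2 hlim] with z hz hzl e
  have he : e = ∑ i, b.repr e i • b i := (b.sum_repr e).symm
  rw [he]
  simp only [map_sum, map_smul]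
  refine tendsto_finsetSum _ fun i _ => ((hzl i).congr fun n => ?_).const_smul _ |>.trans_eq ?_
  · rw [← ((ρ n).hasLineDerivAt_convolution hφ z (b i)).lineDeriv]
    exact (((hsm n).differentiable (by simp)) z).lineDeriv_eq_fderiv
  · rw [hz.lineDeriv_eq_fderiv]

end Mollification

/-! ### Existence, uniqueness and representation of weak solutions. -/

section WeakSolution

open Filter Topology

theorem MeasureTheory.LocallyIntegrable.comp_homeomorph {Y : Type*} [TopologicalSpace Y]
    [LocallyCompactSpace Y] [MeasurableSpace Y] [BorelSpace Y]
    {μ : Measure Y} {g : Y → ℝ} (hg : LocallyIntegrable g μ) (Φ : Y ≃ₜ Y)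
    (hΦ : MeasurePreserving Φ μ μ) : LocallyIntegrable (fun y => g (Φ y)) μ := by
  rw [locallyIntegrable_iff] at hg ⊢
  intro K hK
  have h := (hΦ.integrableOn_comp_preimage Φ.measurableEmbedding (s := Φ '' K)).2
    (hg _ (hK.image Φ.continuous))
  rwa [Φ.injective.preimage_image] at h

theorem MeasureTheory.LocallyIntegrable.comp_snd {Y Z : Type*} [TopologicalSpace Y]
    [TopologicalSpace Z] [LocallyCompactSpace Y] [LocallyCompactSpace Z]
    [MeasurableSpace Y] [MeasurableSpace Z] {μ : Measure Y} {ν : Measure Z}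
    [IsFiniteMeasureOnCompacts μ] [SFinite μ] [SFinite ν]
    {g : Z → ℝ} (hg : LocallyIntegrable g ν) :
    LocallyIntegrable (fun z : Y × Z => g z.2) (μ.prod ν) := by
  rw [locallyIntegrable_iff] at hg ⊢
  intro K hK
  have h1 : IsCompact (Prod.fst '' K) := hK.image continuous_fst
  have h2 : IsCompact (Prod.snd '' K) := hK.image continuous_snd
  have : IsFiniteMeasure (μ.restrict (Prod.fst '' K)) := ⟨by simpa using h1.measure_lt_top⟩
  have h3 : Integrable (fun z : Y × Z => g z.2)
      ((μ.restrict (Prod.fst '' K)).prod (ν.restrict (Prod.snd '' K))) :=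
    Integrable.comp_snd (hg _ h2) _
  rw [Measure.prod_restrict] at h3
  exact IntegrableOn.mono_set h3 fun z hz => ⟨mem_image_of_mem _ hz, mem_image_of_mem _ hz⟩

variable {d : ℕ} {v : Eucl d → Eucl d} {L : ℝ≥0} {X : ℝ → Eucl d → Eucl d}

/-- The operator `∂_t - v · ∇` applied to a function on space-time. -/
noncomputable def transportOp (v : Eucl d → Eucl d) (φ : ℝ × Eucl d → ℝ) (z : ℝ × Eucl d) : ℝ :=
  fderiv ℝ φ z (1, 0) - fderiv ℝ φ z (0, v z.2)

theorem transportOp_eq (v : Eucl d → Eucl d) (φ : ℝ × Eucl d → ℝ) (z : ℝ × Eucl d) :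
    transportOp v φ z = fderiv ℝ φ z (1, -v z.2) := by
  rw [transportOp, ← map_sub]
  simp

theorem continuous_transportOp (hv : Continuous v) {φ : ℝ × Eucl d → ℝ} (hφ : IsTestFunction φ) :
    Continuous (transportOp v φ) := by
  have h := hφ.1.continuous_fderiv (by simp)
  simp only [funext (transportOp_eq v φ)]
  exact h.clm_apply (by fun_prop)

theorem transportOp_eq_zero {φ : ℝ × Eucl d → ℝ} {z : ℝ × Eucl d} (hz : z ∉ tsupport φ) :
    transportOp v φ z = 0 := by
  rw [transportOp_eq, image_eq_zero_of_notMem_tsupport (f := fderiv ℝ φ)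
    fun h => hz (tsupport_fderiv_subset ℝ h)]
  rfl

theorem hasCompactSupport_transportOp {φ : ℝ × Eucl d → ℝ} (hφ : HasCompactSupport φ) :
    HasCompactSupport (transportOp v φ) :=
  HasCompactSupport.intro hφ fun _ hz => transportOp_eq_zero hz

theorem measurableSet_spaceTime : MeasurableSet (spaceTime d) :=
  measurableSet_Ici.prod MeasurableSet.univ

theorem volume_restrict_spaceTime :
    (volume : Measure (ℝ × Eucl d)).restrict (spaceTime d) =
      ((volume : Measure ℝ).restrict (Ici 0)).prod (volume : Measure (Eucl d)) := by
  conv_rhs => rw [← Measure.restrict_univ (μ := (volume : Measure (Eucl d)))]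
  rw [Measure.prod_restrict]
  rfl

theorem isClosed_spaceTime : IsClosed (spaceTime d) := isClosed_Ici.prod isClosed_univ

/-- The derivative of a function on space-time along the characteristics. -/
theorem IsFlow.hasDerivAt_characteristic (hX : IsFlow v X) {φ : ℝ × Eucl d → ℝ} {t : ℝ}
    {y : Eucl d} (hφ : DifferentiableAt ℝ φ (t, X (-t) y)) :
    HasDerivAt (fun s => φ (s, X (-s) y)) (transportOp v φ (t, X (-t) y)) t := by
  have h := hφ.hasFDerivAt.comp_hasDerivAt t ((hasDerivAt_id t).prodMk (hX.neg.hasDerivAt t y))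
  rw [transportOp_eq]
  exact h

/-- Straightening of the characteristics, `(t, x) ↦ (t, X t x)`. -/
@[simps]
noncomputable def IsFlow.spaceTimeHomeomorph (hX : IsFlow v X) (hv : LipschitzWith L v) :
    (ℝ × Eucl d) ≃ₜ (ℝ × Eucl d) where
  toFun z := (z.1, X z.1 z.2)
  invFun z := (z.1, X (-z.1) z.2)
  left_inv z := by simp [hX.map_neg_map hv]
  right_inv z := by simp [hX.map_map_neg hv]
  continuous_toFun := continuous_fst.prodMk (hX.continuous_uncurry hv)
  continuous_invFun := continuous_fst.prodMk
    ((hX.continuous_uncurry hv).comp (continuous_fst.neg.prodMk continuous_snd))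

theorem IsFlow.measurePreserving_spaceTimeHomeomorph (hX : IsFlow v X) (hv : IsLipschitzDivFree v)
    (hL : LipschitzWith L v) : MeasurePreserving (hX.spaceTimeHomeomorph hL) :=
  MeasurePreserving.skew_product (MeasurePreserving.id volume) (g := X)
    (hX.continuous_uncurry hL).measurable (.of_forall fun t => (hX.measurePreserving hv t).map_eq)

/-- After the volume-preserving change of variables `(t, x) ↦ (t, X t x)` the solution no longer
depends on time and `∂_t - v · ∇` becomes `d/dt`; the weak equation is then the fundamental theorem
of calculus on each characteristic. -/
theorem IsFlow.isWeakSolution (hX : IsFlow v X) (hv : IsLipschitzDivFree v) {u₀ : Eucl d → ℝ}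
    (hu : LocallyIntegrable u₀) : IsWeakSolution v u₀ (fun t x => u₀ (X t x)) := by
  have hL := lipschitzWith_lipNorm hv.lipschitz
  set Φ := hX.spaceTimeHomeomorph hL
  have hΦ : MeasurePreserving Φ := hX.measurePreserving_spaceTimeHomeomorph hv hL
  have hu2 : LocallyIntegrable (fun z : ℝ × Eucl d => u₀ z.2) := hu.comp_snd
  refine ⟨(hu2.comp_homeomorph Φ hΦ).locallyIntegrableOn _, fun φ hφ => ?_⟩
  set G := transportOp v φ
  have hGc : Continuous G := continuous_transportOp hL.continuous hφ
  have hGs : HasCompactSupport G := hasCompactSupport_transportOp hφ.2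
  set H : ℝ × Eucl d → ℝ := fun z => u₀ z.2 * G (Φ.symm z)
  have hH : Integrable H :=
    hu2.integrable_smul_right_of_hasCompactSupport (hGc.comp Φ.symm.continuous)
      (hGs.comp_homeomorph Φ.symm)
  have e1 : ∫ z in spaceTime d, u₀ (X z.1 z.2) * G z = ∫ z in spaceTime d, H z := by
    have hpre : Φ ⁻¹' spaceTime d = spaceTime d := by
      ext z; simp [spaceTime, Φ]
    rw [← hΦ.setIntegral_preimage_emb Φ.measurableEmbedding H, hpre]
    refine integral_congr_ae (.of_forall fun z => ?_)
    simp only [H, Φ.symm_apply_apply]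
    rfl
  have e2 : ∫ z in spaceTime d, H z = ∫ y, ∫ t in Ici (0 : ℝ), H (t, y) := by
    rw [volume_restrict_spaceTime, integral_prod_symm]
    rw [← volume_restrict_spaceTime]
    exact hH.integrableOn
  have e3 : ∀ y, ∫ t in Ici (0 : ℝ), H (t, y) = -(u₀ y * φ (0, y)) := by
    intro y
    simp only [H]
    rw [integral_const_mul, integral_Ici_eq_integral_Ioi]
    have hcy : Continuous fun t : ℝ => Φ.symm (t, y) :=
      Φ.symm.continuous.comp (by fun_prop)
    have hcs : HasCompactSupport fun t : ℝ => G (Φ.symm (t, y)) := by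
      refine HasCompactSupport.intro (K := Prod.fst '' tsupport G)
        (IsCompact.image hGs continuous_fst) fun t ht => ?_
      refine image_eq_zero_of_notMem_tsupport fun h => ht ⟨_, h, rfl⟩
    have hcs' : HasCompactSupport fun t : ℝ => φ (Φ.symm (t, y)) := by
      refine HasCompactSupport.intro (K := Prod.fst '' tsupport φ)
        (IsCompact.image hφ.2 continuous_fst) fun t ht => ?_
      refine image_eq_zero_of_notMem_tsupport fun h => ht ⟨_, h, rfl⟩
    have hd : ∀ t, HasDerivAt (fun s => φ (Φ.symm (s, y))) (G (Φ.symm (t, y))) t := fun t =>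
      hX.hasDerivAt_characteristic ((hφ.1.differentiable (by simp)) _)
    rw [integral_Ioi_of_hasDerivAt_of_tendsto (hd 0).continuousAt.continuousWithinAt
      (fun t _ => hd t) ((hGc.comp hcy).integrable_of_hasCompactSupport hcs).integrableOn
      (m := 0) ?_]
    · have : Φ.symm (0, y) = (0, y) := by
        change ((0 : ℝ), X (-0) y) = (0, y)
        rw [neg_zero, hX.map_zero]
      rw [this]; ring
    · exact hcs'.is_zero_at_infty.mono_left atTop_le_cocompact
  change (∫ z in spaceTime d, u₀ (X z.1 z.2) * G z) + _ = 0
  rw [e1, e2]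
  simp only [e3, integral_neg, neg_add_cancel]

/-- `u₀` has no continuity, so the flow is moved onto the test function, whose supports stay in one
compact set for nearby times. -/
theorem IsFlow.isWeaklyContinuous (hX : IsFlow v X) (hv : IsLipschitzDivFree v) {u₀ : Eucl d → ℝ}
    (hu : LocallyIntegrable u₀) : IsWeaklyContinuous (fun t x => u₀ (X t x)) := by
  have hL := lipschitzWith_lipNorm hv.lipschitz
  refine ⟨fun t _ => hu.comp_homeomorph (hX.homeomorph hL t) (hX.measurePreserving hv t),
    fun ψ hψ => ?_⟩
  have e : ∀ t, ∫ x, u₀ (X t x) * ψ x = ∫ y, u₀ y * ψ (X (-t) y) := by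
    intro t
    rw [← (hX.measurePreserving hv t).integral_comp (hX.homeomorph hL t).measurableEmbedding
      (fun y => u₀ y * ψ (X (-t) y))]
    simp only [hX.map_neg_map hL]
  simp only [e]
  have hc := hX.continuous_uncurry hL
  refine ContinuousOn.mono (s := univ) ?_ (subset_univ _)
  rw [continuousOn_univ, continuous_iff_continuousAt]
  intro t
  have hI : Icc (t - 1) (t + 1) ∈ 𝓝 t := Icc_mem_nhds (by linarith) (by linarith)
  refine ContinuousOn.continuousAt (s := Icc (t - 1) (t + 1)) ?_ hI
  have hK : IsCompact ((fun z : ℝ × Eucl d => X z.1 z.2) '' (Icc (t - 1) (t + 1) ×ˢ tsupport ψ)) :=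
    (isCompact_Icc.prod hψ.2).image hc
  refine continuousOn_integral_bilinear_of_locally_integrable_of_compact_support
    (ContinuousLinearMap.mul ℝ ℝ) (f := fun s y => ψ (X (-s) y)) hK ?_ ?_
    (hu.integrableOn_isCompact hK)
  · exact (hψ.1.continuous.comp (hc.comp (continuous_fst.neg.prodMk continuous_snd))).continuousOn
  · intro s y hs hy
    refine image_eq_zero_of_notMem_tsupport fun h => hy ⟨(s, X (-s) y), ⟨hs, h⟩, ?_⟩
    exact hX.map_map_neg hL s y

instance isAddHaarMeasure_volume_spaceTime :
    (volume : Measure (ℝ × Eucl d)).IsAddHaarMeasure :=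
  inferInstanceAs ((volume : Measure ℝ).prod (volume : Measure (Eucl d))).IsAddHaarMeasure

/-- Admits functions of the regularity of `duhamel` in the weak formulation. As `w` is only locally
integrable, dominated convergence needs a common compact support and a uniform derivative bound for
the approximants. -/
theorem integral_mul_transportOp_eq_zero_of_lipschitz (hv : Continuous v) {w : ℝ × Eucl d → ℝ}
    (hw : LocallyIntegrable w)
    (h : ∀ φ, IsTestFunction φ → ∫ z, w z * transportOp v φ z = 0)
    {φ : ℝ × Eucl d → ℝ} {C : ℝ≥0} (hφ : LipschitzWith C φ) (hc : HasCompactSupport φ) :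
    ∫ z, w z * transportOp v φ z = 0 := by
  obtain ⟨f, K, hK, hf, hfK, hfC, hlim⟩ :=
    hφ.exists_testFunction_seq (μ := (volume : Measure (ℝ × Eucl d))) hc
  have hV : Continuous fun z : ℝ × Eucl d => ((1 : ℝ), -v z.2) := by fun_prop
  have hb : Integrable (K.indicator fun z => ‖w z‖ * (C * ‖((1 : ℝ), -v z.2)‖)) :=
    (integrable_indicator_iff hK.measurableSet).2
      (IntegrableOn.mul_continuousOn (hw.integrableOn_isCompact hK).norm (by fun_prop) hK)
  have ht : Tendsto (fun n => ∫ z, w z * transportOp v (f n) z) atTop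
      (𝓝 (∫ z, w z * transportOp v φ z)) := by
    refine tendsto_integral_of_dominated_convergence _
      (fun n => hw.aestronglyMeasurable.mul
        (continuous_transportOp hv (hf n)).aestronglyMeasurable) hb
      (fun n => .of_forall fun z => ?_) ?_
    · by_cases hz : z ∈ K
      · rw [indicator_of_mem hz, norm_mul, transportOp_eq]
        gcongr
        exact (fderiv ℝ (f n) z).le_of_opNorm_le (hfC n z) _
      · rw [indicator_of_notMem hz, transportOp_eq_zero fun h => hz (hfK n h), mul_zero, norm_zero]
    · filter_upwards [hlim] with z hz
      simp only [transportOp_eq]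
      exact (hz _).const_mul _
  simp only [fun n => h (f n) (hf n)] at ht
  exact (tendsto_nhds_unique ht tendsto_const_nhds)

/-- Duhamel's formula for the adjoint transport equation with right-hand side `ψ`. -/
noncomputable def duhamel (X : ℝ → Eucl d → Eucl d) (A : ℝ) (ψ : ℝ × Eucl d → ℝ)
    (z : ℝ × Eucl d) : ℝ :=
  -∫ h in (0 : ℝ)..A, ψ (z.1 + h, X (-h) z.2)

theorem IsFlow.lipschitzWith_duhamel (hX : IsFlow v X) (hv : LipschitzWith L v) {A : ℝ}
    (hA : 0 ≤ A) {ψ : ℝ × Eucl d → ℝ} {C : ℝ≥0} (hψ : LipschitzWith C ψ) :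
    LipschitzWith (C * (Real.exp (L * A)).toNNReal * A.toNNReal) (duhamel X A ψ) := by
  have hc : ∀ z : ℝ × Eucl d, Continuous fun h => ψ (z.1 + h, X (-h) z.2) := fun z =>
    hψ.continuous.comp ((continuous_const.add continuous_id).prodMk
      ((hX.continuous_uncurry hv).comp (continuous_neg.prodMk continuous_const)))
  refine LipschitzWith.of_dist_le_mul fun z z' => ?_
  have hM : 1 ≤ Real.exp (L * A) := Real.one_le_exp (by positivity)
  rw [duhamel, duhamel, dist_neg_neg, dist_eq_norm, ← intervalIntegral.integral_sub
    ((hc z).intervalIntegrable _ _) ((hc z').intervalIntegrable _ _)]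
  have := intervalIntegral.norm_integral_le_of_norm_le_const (a := 0) (b := A)
    (f := fun h => ψ (z.1 + h, X (-h) z.2) - ψ (z'.1 + h, X (-h) z'.2))
    (C := C * (Real.exp (L * A) * dist z z')) (fun h hh => by
      rw [uIoc_of_le hA] at hh
      rw [← dist_eq_norm]
      refine (hψ.dist_le_mul _ _).trans ?_
      gcongr
      rw [Prod.dist_eq, max_le_iff]
      constructor
      · simp only [dist_add_right]
        exact (le_max_left _ _ : dist z.1 z'.1 ≤ dist z z').trans
          (le_mul_of_one_le_left (dist_nonneg (x := z) (y := z')) hM)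
      · refine (hX.dist_le hv _ _ _).trans ?_
        gcongr
        · rw [abs_neg, abs_of_pos hh.1]; exact hh.2
        · exact le_max_right _ _)
  rw [sub_zero, abs_of_nonneg hA] at this
  refine this.trans_eq ?_
  push_cast
  rw [Real.coe_toNNReal _ hA, Real.coe_toNNReal _ (Real.exp_pos _).le]
  ring

theorem IsFlow.hasCompactSupport_duhamel (hX : IsFlow v X) (hv : LipschitzWith L v) {A : ℝ}
    (hA : 0 ≤ A) {ψ : ℝ × Eucl d → ℝ} (hψ : HasCompactSupport ψ) :
    HasCompactSupport (duhamel X A ψ) := by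
  refine HasCompactSupport.intro
    (K := (fun q : ℝ × (ℝ × Eucl d) => (q.2.1 - q.1, X q.1 q.2.2)) '' (Icc 0 A ×ˢ tsupport ψ))
    ((isCompact_Icc.prod hψ).image ?_) fun z hz => ?_
  · exact (by fun_prop : Continuous fun q : ℝ × (ℝ × Eucl d) => q.2.1 - q.1).prodMk
      ((hX.continuous_uncurry hv).comp (by fun_prop :
        Continuous fun q : ℝ × (ℝ × Eucl d) => (q.1, q.2.2)))
  · rw [duhamel, neg_eq_zero]
    refine (intervalIntegral.integral_congr fun h hh => ?_).trans
      intervalIntegral.integral_zero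
    rw [uIcc_of_le hA] at hh
    refine image_eq_zero_of_notMem_tsupport fun h' => hz ⟨(h, (z.1 + h, X (-h) z.2)), ⟨hh, h'⟩, ?_⟩
    simp [hX.map_map_neg hv]

/-- Along the characteristic through `z`, `duhamel` is minus the integral of one function `g` over a
window `[k, k + A]`; moving the window at `k = 0` yields `g 0 - g A`. -/
theorem IsFlow.transportOp_duhamel (hX : IsFlow v X) (hv : LipschitzWith L v) {A : ℝ}
    {ψ : ℝ × Eucl d → ℝ} (hψ : Continuous ψ) {z : ℝ × Eucl d}
    (hz : DifferentiableAt ℝ (duhamel X A ψ) z) :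
    transportOp v (duhamel X A ψ) z = ψ z - ψ (z.1 + A, X (-A) z.2) := by
  obtain ⟨t, x⟩ := z
  set g : ℝ → ℝ := fun h => ψ (t + h, X (-h) x) with hg
  have hgc : Continuous g := hψ.comp ((continuous_const.add continuous_id).prodMk
    ((hX.continuous_uncurry hv).comp (continuous_neg.prodMk continuous_const)))
  have h1 : HasDerivAt (fun k => duhamel X A ψ (t + k, X (-k) x))
      (transportOp v (duhamel X A ψ) (t, x)) 0 := by
    have hz' : DifferentiableAt ℝ (duhamel X A ψ) (t + 0, X (-0) x) := by
      rwa [add_zero, neg_zero, hX.map_zero]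
    have := hz'.hasFDerivAt.comp_hasDerivAt 0
      (((hasDerivAt_id (0 : ℝ)).const_add t).prodMk (hX.neg.hasDerivAt 0 x))
    rw [add_zero, neg_zero, hX.map_zero] at this
    rw [transportOp_eq]
    exact this
  have h2 : ∀ k, duhamel X A ψ (t + k, X (-k) x) =
      (∫ h in (0 : ℝ)..k, g h) - ∫ h in (0 : ℝ)..(k + A), g h := by
    intro k
    have e : ∀ h, ψ (t + k + h, X (-h) (X (-k) x)) = g (k + h) := by
      intro h
      simp only [hg, ← hX.map_add hv, add_assoc, neg_add_rev]
    simp only [duhamel, e]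
    rw [intervalIntegral.integral_comp_add_left g, add_zero,
      ← intervalIntegral.integral_interval_sub_left (hgc.intervalIntegrable _ _)
        (hgc.intervalIntegrable _ _)]
    ring
  have h3 : HasDerivAt (fun k => duhamel X A ψ (t + k, X (-k) x)) (g 0 - g A) 0 := by
    simp only [h2]
    refine (hgc.integral_hasStrictDerivAt 0 0).hasDerivAt.sub ?_
    have := (hgc.integral_hasStrictDerivAt 0 (0 + A)).hasDerivAt.comp_add_const 0 A
    rwa [zero_add] at this
  rw [h1.unique h3]
  simp [hg, hX.map_zero]

/-- Duality: testing with `duhamel X A ψ`, which is Lipschitz with compact support, turns the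
hypothesis into `∫ w ψ = 0`. -/
theorem ae_eq_zero_of_integral_mul_transportOp_eq_zero (hv : IsLipschitzDivFree v)
    {w : ℝ × Eucl d → ℝ} (hw : LocallyIntegrable w) (hsupp : ∀ z ∉ spaceTime d, w z = 0)
    (h : ∀ φ, IsTestFunction φ → ∫ z, w z * transportOp v φ z = 0) : ∀ᵐ z, w z = 0 := by
  have hL := lipschitzWith_lipNorm hv.lipschitz
  obtain ⟨X, hX⟩ := exists_isFlow hL
  refine ae_eq_zero_of_integral_contDiff_smul_eq_zero hw fun ψ hψ hψc => ?_
  obtain ⟨C, hC⟩ := hψ.lipschitzWith_of_hasCompactSupport hψc (by simp)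
  obtain ⟨T, hT⟩ : ∃ T, ∀ z ∈ tsupport ψ, ‖z.1‖ ≤ T :=
    IsCompact.exists_bound_of_continuousOn hψc continuous_fst.continuousOn
  -- `A` exceeds every time in the support of `ψ`, so the end term vanishes for `t ≥ 0`; for `t < 0`
  -- the function `w` is zero. A finite `A` keeps the support of `duhamel` compact.
  set A := |T| + 1
  have hA : 0 ≤ A := by positivity
  have hlip := hX.lipschitzWith_duhamel hL hA hC
  rw [← integral_mul_transportOp_eq_zero_of_lipschitz hL.continuous hw h hlip
    (hX.hasCompactSupport_duhamel hL hA hψc)]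
  refine integral_congr_ae ?_
  filter_upwards [hlip.ae_differentiableAt] with z hz
  by_cases hzS : z ∈ spaceTime d
  · have : ψ (z.1 + A, X (-A) z.2) = 0 := by
      refine image_eq_zero_of_notMem_tsupport fun h' => ?_
      have h0 : 0 ≤ z.1 := hzS.1
      have h1 := hT _ h'
      simp only [Real.norm_eq_abs] at h1
      have h2 := le_abs_self (z.1 + A)
      have h3 := le_abs_self T
      simp only [A] at h1 h2
      linarith
    rw [hX.transportOp_duhamel hL hψ.continuous hz, this, sub_zero, smul_eq_mul, mul_comm]
  · simp [hsupp z hzS]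

theorem MeasureTheory.LocallyIntegrableOn.locallyIntegrable_indicator {Y : Type*}
    [TopologicalSpace Y] [LocallyCompactSpace Y] [MeasurableSpace Y] [OpensMeasurableSpace Y]
    {μ : Measure Y} {f : Y → ℝ} {S : Set Y} (hf : LocallyIntegrableOn f S μ) (hS : IsClosed S) :
    LocallyIntegrable (S.indicator f) μ := by
  rw [locallyIntegrable_iff]
  intro K hK
  rw [IntegrableOn, integrable_indicator_iff hS.measurableSet, IntegrableOn,
    Measure.restrict_restrict hS.measurableSet]
  exact hf.integrableOn_compact_subset inter_subset_left (hK.inter_left hS)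

/-- Uniqueness of locally integrable weak solutions. -/
theorem IsWeakSolution.ae_eq (hv : IsLipschitzDivFree v) {u₀ : Eucl d → ℝ}
    {u w : ℝ → Eucl d → ℝ} (hu : IsWeakSolution v u₀ u) (hw : IsWeakSolution v u₀ w) :
    (fun z : ℝ × Eucl d => u z.1 z.2) =ᵐ[volume.restrict (spaceTime d)]
      fun z : ℝ × Eucl d => w z.1 z.2 := by
  have hL := lipschitzWith_lipNorm hv.lipschitz
  have hu' := hu.locallyIntegrable.locallyIntegrable_indicator isClosed_spaceTime
  have hw' := hw.locallyIntegrable.locallyIntegrable_indicator isClosed_spaceTime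
  have key := ae_eq_zero_of_integral_mul_transportOp_eq_zero hv (hu'.sub hw')
    (fun z hz => by simp [hz]) fun φ hφ => by
      have hc := continuous_transportOp hL.continuous hφ
      have hs := hasCompactSupport_transportOp (v := v) hφ.2
      have e : ∀ r : ℝ → Eucl d → ℝ, ∫ z, (spaceTime d).indicator
          (fun z : ℝ × Eucl d => r z.1 z.2) z * transportOp v φ z =
          ∫ z in spaceTime d, r z.1 z.2 * transportOp v φ z := by
        intro r
        rw [← integral_indicator measurableSet_spaceTime]
        simp only [indicator_mul_left]
      simp only [Pi.sub_apply, ← smul_eq_mul, sub_smul]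
      rw [integral_sub (hu'.integrable_smul_right_of_hasCompactSupport hc hs)
        (hw'.integrable_smul_right_of_hasCompactSupport hc hs)]
      simp only [smul_eq_mul, e]
      have h1 := hu.weak_eq φ hφ
      have h2 := hw.weak_eq φ hφ
      simp only [transportOp]
      linarith
  rw [EventuallyEq, ae_restrict_iff' measurableSet_spaceTime]
  filter_upwards [key] with z hz hzS
  simp only [Pi.sub_apply, indicator_of_mem hzS] at hz
  linarith

/-- A weakly continuous weak solution is given by the flow at every time. -/
theorem IsWeakSolution.ae_eq_comp_flow (hv : IsLipschitzDivFree v) (hX : IsFlow v X)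
    {u₀ : Eucl d → ℝ} (hu₀ : LocallyIntegrable u₀) {u : ℝ → Eucl d → ℝ}
    (hu : IsWeakSolution v u₀ u) (hc : IsWeaklyContinuous u) {t : ℝ} (ht : 0 ≤ t) :
    u t =ᵐ[volume] fun x => u₀ (X t x) := by
  have hw := hX.isWeakSolution hv hu₀
  have hwc := hX.isWeaklyContinuous hv hu₀
  have h1 := hu.ae_eq hv hw
  rw [volume_restrict_spaceTime] at h1
  have h2 := Measure.ae_ae_of_ae_prod h1
  refine ae_eq_of_integral_contDiff_smul_eq (hc.locallyIntegrable t ht)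
    (hwc.locallyIntegrable t ht) fun ψ hψ hψc => ?_
  -- Uniqueness gives equality at almost every time; continuity on `[0, ∞)` removes the exceptional
  -- times.
  have h3 : (fun s => ∫ x, u s x * ψ x) =ᵐ[volume.restrict (Ici 0)]
      fun s => ∫ x, u₀ (X s x) * ψ x := by
    filter_upwards [h2] with s hs
    refine integral_congr_ae ?_
    filter_upwards [hs] with x hx
    simp only [hx]
  have h4 := Measure.eqOn_of_ae_eq (X := ℝ) h3 (hc.continuousOn ψ ⟨hψ, hψc⟩)
    (hwc.continuousOn ψ ⟨hψ, hψc⟩) (by simp [closure_Ioi]) ht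
  simpa only [smul_eq_mul, mul_comm] using h4

end WeakSolution

/-! ### Averages on balls and Campanato's estimate. -/

section MeanOscillation

open Filter Topology

open Metric

variable {d : ℕ} {f : Eucl d → ℝ}

theorem volume_real_ball_pos (x : Eucl d) {r : ℝ} (hr : 0 < r) : 0 < volume.real (ball x r) :=
  ENNReal.toReal_pos (measure_ball_pos _ _ hr).ne' measure_ball_lt_top.ne

theorem volume_ball_mul (x y : Eucl d) {k r : ℝ} (hk : 0 < k) (hr : 0 < r) :
    volume (ball x (k * r)) = ENNReal.ofReal (k ^ d) * volume (ball y r) := by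
  rw [Measure.addHaar_ball_of_pos _ _ (mul_pos hk hr), Measure.addHaar_ball_of_pos _ _ hr,
    mul_pow, ENNReal.ofReal_mul (by positivity), finrank_euclideanSpace_fin, mul_assoc]

theorem volume_real_ball_mul (x y : Eucl d) {k r : ℝ} (hk : 0 < k) (hr : 0 < r) :
    volume.real (ball x (k * r)) = k ^ d * volume.real (ball y r) := by
  rw [Measure.real, volume_ball_mul x y hk hr, ENNReal.toReal_mul,
    ENNReal.toReal_ofReal (by positivity), Measure.real]

theorem MeasureTheory.LocallyIntegrable.integrableOn_ball (hf : LocallyIntegrable f) (x : Eucl d)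
    (r : ℝ) : IntegrableOn f (ball x r) :=
  (hf.integrableOn_isCompact (isCompact_closedBall x r)).mono_set ball_subset_closedBall

theorem MeasureTheory.LocallyIntegrable.integrableOn_ball_abs_sub (hf : LocallyIntegrable f)
    (x : Eucl d) (r c : ℝ) : IntegrableOn (fun y => |f y - c|) (ball x r) :=
  ((hf.integrableOn_ball x r).sub (integrableOn_const measure_ball_lt_top.ne)).abs

/-- An average differs from a constant by at most the average deviation. -/
theorem abs_setAverage_sub_le {s : Set (Eucl d)} (h0 : volume s ≠ 0) (h1 : volume s ≠ ⊤)
    (hf : IntegrableOn f s) (c : ℝ) :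
    |(⨍ y in s, f y) - c| ≤ (volume.real s)⁻¹ * ∫ y in s, |f y - c| := by
  have hpos : 0 < volume.real s := ENNReal.toReal_pos h0 h1
  have e : (⨍ y in s, f y) - c = (volume.real s)⁻¹ * ∫ y in s, (f y - c) := by
    rw [integral_sub hf (integrableOn_const h1), setIntegral_const, setAverage_eq, smul_eq_mul,
      smul_eq_mul]
    field_simp
  rw [e, abs_mul, abs_of_pos (inv_pos.2 hpos)]
  gcongr
  exact abs_integral_le_integral_abs

/-- The mean oscillation of `f` on balls of radius `r` is at most `H r ^ a`. -/
def MeanOscLE (f : Eucl d → ℝ) (a H : ℝ) : Prop :=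
  ∀ (x : Eucl d) (r : ℝ), 0 < r →
    ∫ y in ball x r, |f y - ⨍ z in ball x r, f z| ≤ H * r ^ a * volume.real (ball x r)

/-- The smaller ball fills a fraction `k^{-d}` of the larger, so averaging over it costs a factor
`k^d`. -/
theorem MeanOscLE.abs_setAverage_sub_setAverage_le {a H : ℝ} (h : MeanOscLE f a H)
    (hf : LocallyIntegrable f) {x y : Eucl d} {k r : ℝ} (hk : 0 < k) (hr : 0 < r)
    (hs : ball y r ⊆ ball x (k * r)) :
    |(⨍ z in ball y r, f z) - ⨍ z in ball x (k * r), f z| ≤ k ^ d * (H * (k * r) ^ a) := by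
  have hpos := volume_real_ball_pos y hr
  refine (abs_setAverage_sub_le (measure_ball_pos _ _ hr).ne' measure_ball_lt_top.ne
    (hf.integrableOn_ball y r) _).trans ?_
  rw [inv_mul_le_iff₀ hpos]
  calc ∫ z in ball y r, |f z - ⨍ z in ball x (k * r), f z|
      ≤ ∫ z in ball x (k * r), |f z - ⨍ z in ball x (k * r), f z| :=
        setIntegral_mono_set (hf.integrableOn_ball_abs_sub _ _ _)
          (.of_forall fun _ => abs_nonneg _) hs.eventuallyLE
    _ ≤ H * (k * r) ^ a * volume.real (ball x (k * r)) := h x _ (mul_pos hk hr)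
    _ = _ := by rw [volume_real_ball_mul x y hk hr]; ring

theorem ae_tendsto_setAverage_ball (hf : LocallyIntegrable f) {R : ℝ} (hR : 0 < R) :
    ∀ᵐ x, Tendsto (fun k : ℕ => ⨍ y in ball x (R * (1 / 2) ^ k), f y) atTop (𝓝 (f x)) := by
  have hpos : ∀ k : ℕ, 0 < R * (1 / 2 : ℝ) ^ k := fun k => by positivity
  have hlim : Tendsto (fun k : ℕ => R * (1 / 2 : ℝ) ^ k) atTop (𝓝[>] 0) := by
    refine tendsto_nhdsWithin_iff.2 ⟨?_, .of_forall hpos⟩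
    simpa using (tendsto_pow_atTop_nhds_zero_of_lt_one (r := (1 / 2 : ℝ)) (by norm_num)
      (by norm_num)).const_mul R
  filter_upwards [IsUnifLocDoublingMeasure.ae_tendsto_average (μ := volume) hf 1] with x hx
  have := hx (fun _ => x) _ hlim (.of_forall fun k => by
    rw [one_mul]; exact mem_closedBall_self (hpos k).le)
  refine this.congr fun k => ?_
  have h0 : volume (sphere x (R * (1 / 2 : ℝ) ^ k)) = 0 :=
    Measure.addHaar_sphere_of_ne_zero _ _ (hpos k).ne'
  refine (setAverage_congr ?_).symm
  rw [← ball_union_sphere]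
  exact (union_ae_eq_left_of_ae_eq_empty (ae_eq_empty.2 h0)).symm

/-- Campanato's estimate: a function with mean oscillation `O(r ^ a)` is almost everywhere close
to its averages. -/
theorem MeanOscLE.ae_abs_sub_setAverage_le {a H : ℝ} (ha : 0 < a) (h : MeanOscLE f a H)
    (hf : LocallyIntegrable f) (z : Eucl d) {R : ℝ} (hR : 0 < R) :
    ∀ᵐ x, x ∈ ball z R → |f x - ⨍ y in ball z (2 * R), f y| ≤
      (2 ^ d / (1 - (1 / 2) ^ a) + 2 ^ d * 2 ^ a) * (H * R ^ a) := by
  filter_upwards [ae_tendsto_setAverage_ball hf hR] with x hx hxz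
  -- Consecutive dyadic averages about `x` differ by at most `2^d H (R 2^{-k})^a`, a geometric
  -- series since `a > 0`. Its sum is the first term of the constant; the second compares `ball x R`
  -- with `ball z (2 * R)`.
  have h1 := dist_le_of_le_geometric_of_tendsto₀ ((1 / 2 : ℝ) ^ a) (2 ^ d * (H * R ^ a))
    (Real.rpow_lt_one (by norm_num) (by norm_num) ha) (fun k => by
      have e : R * (1 / 2 : ℝ) ^ k = 2 * (R * (1 / 2 : ℝ) ^ (k + 1)) := by rw [pow_succ]; ring
      rw [dist_comm, Real.dist_eq]
      have hp : 0 < R * (1 / 2 : ℝ) ^ (k + 1) := by positivity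
      rw [e]
      refine (h.abs_setAverage_sub_setAverage_le hf two_pos hp
        (ball_subset_ball (by linarith))).trans_eq ?_
      rw [← e, Real.mul_rpow hR.le (by positivity), ← Real.rpow_natCast_mul (by norm_num),
        ← Real.rpow_mul_natCast (by norm_num), mul_comm a]
      ring) hx
  have h2 := h.abs_setAverage_sub_setAverage_le hf (x := z) (y := x) two_pos hR
    (ball_subset_ball' (by rw [mem_ball] at hxz; linarith))
  rw [Real.dist_eq, pow_zero, mul_one, abs_sub_comm] at h1
  rw [Real.mul_rpow two_pos.le hR.le] at h2
  calc |f x - ⨍ y in ball z (2 * R), f y|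
      ≤ |f x - ⨍ y in ball x R, f y| + |(⨍ y in ball x R, f y) - ⨍ y in ball z (2 * R), f y| :=
        abs_sub_le _ _ _
    _ ≤ _ := add_le_add h1 h2
    _ = _ := by ring

end MeanOscillation

/-! ### A John–Nirenberg estimate by stopping balls. -/

section JohnNirenberg

open Filter Topology

open Metric

variable {d : ℕ} {f : Eucl d → ℝ}

theorem MeasureTheory.LocallyIntegrable.ofReal_setIntegral_abs_sub (hf : LocallyIntegrable f)
    {s : Set (Eucl d)} {x : Eucl d} {r : ℝ} (hs : s ⊆ ball x r) (c : ℝ) :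
    ENNReal.ofReal (∫ y in s, |f y - c|) = ∫⁻ y in s, ‖f y - c‖ₑ := by
  rw [ofReal_integral_eq_lintegral_ofReal ((hf.integrableOn_ball_abs_sub x r c).mono_set hs)
    (.of_forall fun _ => abs_nonneg _)]
  simp only [← Real.norm_eq_abs, ofReal_norm]

/-- Stopping balls are centred in `ball x R` but may leave it; they stay inside the double ball. -/
theorem MeanOscLE.setIntegral_ball_two_mul_le {N : ℝ} (h : MeanOscLE f 0 N)
    (hf : LocallyIntegrable f) (x : Eucl d) {R : ℝ} (hR : 0 < R) :
    ∫ y in ball x (2 * R), |f y - ⨍ z in ball x R, f z| ≤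
      (1 + 2 ^ d) * 2 ^ d * N * volume.real (ball x R) := by
  have hb := h.abs_setAverage_sub_setAverage_le hf (x := x) (y := x) two_pos hR
    (ball_subset_ball (by linarith))
  rw [Real.rpow_zero, mul_one, abs_sub_comm] at hb
  set c2 := ⨍ z in ball x (2 * R), f z
  set c1 := ⨍ z in ball x R, f z
  calc ∫ y in ball x (2 * R), |f y - c1|
      ≤ ∫ y in ball x (2 * R), (|f y - c2| + |c2 - c1|) :=
        setIntegral_mono (hf.integrableOn_ball_abs_sub _ _ _)
          ((hf.integrableOn_ball_abs_sub _ _ _).add (integrableOn_const measure_ball_lt_top.ne))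
          fun y => abs_sub_le _ _ _
    _ = (∫ y in ball x (2 * R), |f y - c2|) + volume.real (ball x (2 * R)) * |c2 - c1| := by
        rw [integral_add (hf.integrableOn_ball_abs_sub _ _ _)
          (integrableOn_const measure_ball_lt_top.ne), setIntegral_const, smul_eq_mul]
    _ ≤ N * (2 * R) ^ (0 : ℝ) * volume.real (ball x (2 * R)) +
          volume.real (ball x (2 * R)) * (2 ^ d * N) := by
        gcongr
        exact h x _ (by positivity)
    _ = _ := by
        rw [volume_real_ball_mul x x two_pos hR, Real.rpow_zero]; ring

/-- The constant in the stopping-ball decomposition. -/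
def stoppingConst (d : ℕ) : ℝ := 5 ^ d + 2 ^ d * (2 * 5 ^ d * ((1 + 2 ^ d) * 2 ^ d))

/-- A Calderón–Zygmund type decomposition of a ball at a height comparable to the mean
oscillation. -/
theorem MeanOscLE.exists_stopping_balls {N : ℝ} (hN : 0 < N) (h : MeanOscLE f 0 N)
    (hf : LocallyIntegrable f) (x₀ : Eucl d) {R : ℝ} (hR : 0 < R) :
    ∃ (u : Set (Eucl d)) (ρ : Eucl d → ℝ), u.Countable ∧ (∀ b ∈ u, 0 < ρ b) ∧
      (∑' b : u, volume (ball (b : Eucl d) (ρ b)) ≤ volume (ball x₀ R) / 2) ∧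
      (∀ b ∈ u, |(⨍ y in ball b (ρ b), f y) - ⨍ y in ball x₀ R, f y| ≤ stoppingConst d * N) ∧
      ∀ᵐ x, x ∈ ball x₀ R → x ∉ ⋃ b ∈ u, ball b (ρ b) →
        |f x - ⨍ y in ball x₀ R, f y| ≤ stoppingConst d * N := by
  set c := ⨍ y in ball x₀ R, f y with hc
  set A : ℝ := (1 + 2 ^ d) * 2 ^ d with hA
  have hApos : 0 < A := by positivity
  -- Disjoint balls on which `|f - c|` has average above `lam` have total volume at most `A N |B| /
  -- lam`. The factor `2 * 5 ^ d` leaves at most `|B| / 2` after the fivefold Vitali enlargement.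
  set lam : ℝ := 2 * 5 ^ d * A * N with hlam
  have hlampos : 0 < lam := by positivity
  have hAN : A * N < lam := by
    have h5 : (1 : ℝ) ≤ 5 ^ d := one_le_pow₀ (by norm_num)
    have : 0 < A * N := by positivity
    rw [hlam]; nlinarith
  have hI := h.setIntegral_ball_two_mul_le hf x₀ hR
  rw [← hc, ← hA] at hI
  have hsub : ∀ x ∈ ball x₀ R, ∀ k : ℕ, ball x (R * (1 / 2) ^ k) ⊆ ball x₀ (2 * R) := by
    intro x hx k
    refine ball_subset_ball' ?_
    have : R * (1 / 2 : ℝ) ^ k ≤ R :=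
      mul_le_of_le_one_right hR.le (pow_le_one₀ (by norm_num) (by norm_num))
    rw [mem_ball] at hx
    linarith
  -- `P x k`: the deviation from `c` is large on the `k`-th dyadic ball about `x`
  let P : Eucl d → ℕ → Prop := fun x k =>
    lam * volume.real (ball x (R * (1 / 2) ^ k)) < ∫ y in ball x (R * (1 / 2) ^ k), |f y - c|
  let S : Set (Eucl d) := {x | x ∈ ball x₀ R ∧ ∃ k, P x k}
  have hradius : ∀ x ∈ S, ∃ r, 0 < r ∧ r ≤ R ∧ ball x r ⊆ ball x₀ (2 * R) ∧
      lam * volume.real (ball x r) < ∫ y in ball x r, |f y - c| ∧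
      ∫ y in ball x r, |f y - c| ≤ 2 ^ d * lam * volume.real (ball x r) := by
    classical
    rintro x ⟨hx, hk⟩
    have hspec := Nat.find_spec hk
    have hmin := fun m => Nat.find_min hk (m := m)
    set k := Nat.find hk
    -- At scale `R` the average is at most `A N < lam`, so stopping occurs later; the preceding
    -- ball, of twice the radius, did not stop, whence the upper bound `2^d lam`.
    have hk0 : k ≠ 0 := by
      intro hk0
      have h1 : lam * volume.real (ball x (R * (1 / 2) ^ k)) <
          ∫ y in ball x (R * (1 / 2) ^ k), |f y - c| := hspec
      have h2 := setIntegral_mono_set (hf.integrableOn_ball_abs_sub x₀ (2 * R) c)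
        (.of_forall fun _ => abs_nonneg _) (hsub x hx k).eventuallyLE
      rw [hk0, pow_zero, mul_one] at h1 h2
      have h3 : volume.real (ball x R) = volume.real (ball x₀ R) := by
        simpa using volume_real_ball_mul x x₀ one_pos hR
      rw [h3] at h1
      have := volume_real_ball_pos x₀ hR
      nlinarith
    obtain ⟨m, hm⟩ := Nat.exists_eq_succ_of_ne_zero hk0
    have hPm : ¬ P x m := hmin m (by omega)
    simp only [P, not_lt] at hPm
    have hpos : 0 < R * (1 / 2 : ℝ) ^ k := by positivity
    have e : R * (1 / 2 : ℝ) ^ m = 2 * (R * (1 / 2 : ℝ) ^ k) := by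
      rw [hm, pow_succ]; ring
    refine ⟨R * (1 / 2) ^ k, hpos, mul_le_of_le_one_right hR.le
      (pow_le_one₀ (by norm_num) (by norm_num)), hsub x hx k, hspec, ?_⟩
    rw [e, volume_real_ball_mul x x two_pos hpos] at hPm
    refine (setIntegral_mono_set (hf.integrableOn_ball_abs_sub x _ c)
        (.of_forall fun _ => abs_nonneg _)
        (ball_subset_ball (by linarith : R * (1 / 2 : ℝ) ^ k ≤ 2 * (R * (1 / 2) ^ k))).eventuallyLE).trans ?_
    linarith
  choose! r hr0 hrR hrsub hrlow hrup using hradius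
  obtain ⟨u, huS, hudisj, hucov⟩ := Vitali.exists_disjoint_subfamily_covering_enlargement_ball
    S (fun x => x) r R hrR 5 (by norm_num)
  have hucount : u.Countable := hudisj.countable_of_isOpen (fun _ _ => isOpen_ball)
    fun b hb => nonempty_ball.2 (hr0 b (huS hb))
  refine ⟨u, fun b => 5 * r b, hucount, fun b hb => mul_pos (by norm_num) (hr0 b (huS hb)), ?_,
    fun b hb => ?_, ?_⟩
  · have hsum : ENNReal.ofReal lam * ∑' b : u, volume (ball (b : Eucl d) (r b)) ≤
        ENNReal.ofReal (A * N) * volume (ball x₀ R) := by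
      calc ENNReal.ofReal lam * ∑' b : u, volume (ball (b : Eucl d) (r b))
          = ∑' b : u, ENNReal.ofReal lam * volume (ball (b : Eucl d) (r b)) :=
            ENNReal.tsum_mul_left.symm
        _ ≤ ∑' b : u, ∫⁻ y in ball (b : Eucl d) (r b), ‖f y - c‖ₑ := by
            refine ENNReal.tsum_le_tsum fun b => ?_
            rw [← hf.ofReal_setIntegral_abs_sub (hrsub b (huS b.2)),
              ← ofReal_measureReal measure_ball_lt_top.ne, ← ENNReal.ofReal_mul hlampos.le]
            exact ENNReal.ofReal_le_ofReal (hrlow b (huS b.2)).le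
        _ = ∫⁻ y in ⋃ b ∈ u, ball b (r b), ‖f y - c‖ₑ :=
            (lintegral_biUnion hucount (fun _ _ => measurableSet_ball) hudisj _).symm
        _ ≤ ∫⁻ y in ball x₀ (2 * R), ‖f y - c‖ₑ :=
            lintegral_mono_set (iUnion₂_subset fun b hb => hrsub b (huS hb))
        _ ≤ ENNReal.ofReal (A * N * volume.real (ball x₀ R)) := by
            rw [← hf.ofReal_setIntegral_abs_sub Subset.rfl]
            exact ENNReal.ofReal_le_ofReal hI
        _ = ENNReal.ofReal (A * N) * volume (ball x₀ R) := by
            rw [ENNReal.ofReal_mul (by positivity), ofReal_measureReal measure_ball_lt_top.ne]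
    have h5 : ∑' b : u, volume (ball (b : Eucl d) (5 * r b)) =
        ENNReal.ofReal (5 ^ d) * ∑' b : u, volume (ball (b : Eucl d) (r b)) := by
      rw [← ENNReal.tsum_mul_left]
      exact tsum_congr fun b => volume_ball_mul _ _ (by norm_num) (hr0 b (huS b.2))
    rw [h5, ENNReal.le_div_iff_mul_le (by simp) (by simp)]
    have e : ENNReal.ofReal lam =
        ENNReal.ofReal (A * N) * (ENNReal.ofReal (5 ^ d) * 2) := by
      rw [hlam, show (2 : ℝ≥0∞) = ENNReal.ofReal 2 by simp,
        ← ENNReal.ofReal_mul (by positivity), ← ENNReal.ofReal_mul (by positivity)]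
      congr 1; ring
    rw [e, mul_assoc] at hsum
    have hne : ENNReal.ofReal (A * N) ≠ 0 := by
      rw [Ne, ENNReal.ofReal_eq_zero, not_le]; positivity
    have := (ENNReal.mul_le_mul_iff_right hne ENNReal.ofReal_ne_top).1 hsum
    calc _ = _ := by ring
      _ ≤ _ := this
  · have hb0 := hr0 b (huS hb)
    -- Enlarging the ball five times moves its average by at most `5^d N`, and the unenlarged
    -- average is within `2^d lam` of `c`: the two terms of `stoppingConst`.
    have h1 := h.abs_setAverage_sub_setAverage_le hf (x := b) (y := b)
      (by norm_num : (0 : ℝ) < 5) hb0 (ball_subset_ball (by linarith))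
    rw [Real.rpow_zero, mul_one, abs_sub_comm] at h1
    have h2 := abs_setAverage_sub_le (measure_ball_pos volume b hb0).ne' measure_ball_lt_top.ne
      (hf.integrableOn_ball b (r b)) c
    have hpos := volume_real_ball_pos b hb0
    have h3 : (volume.real (ball b (r b)))⁻¹ * ∫ y in ball b (r b), |f y - c| ≤ 2 ^ d * lam := by
      rw [inv_mul_le_iff₀ hpos]
      linarith [hrup b (huS hb)]
    refine (abs_sub_le _ (⨍ y in ball b (r b), f y) _).trans
      ((add_le_add h1 (h2.trans h3)).trans_eq ?_)
    rw [stoppingConst, hlam]; ring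
  · have hloc : LocallyIntegrable fun y => |f y - c| :=
      locallyIntegrable_iff.2 fun K hK =>
        ((hf.integrableOn_isCompact hK).sub (integrableOn_const hK.measure_lt_top.ne)).abs
    -- Off the enlarged balls no dyadic average of `|f - c|` exceeds `lam`, hence neither does its
    -- Lebesgue limit.
    filter_upwards [ae_tendsto_setAverage_ball hloc hR] with x hx hxB hxU
    have hxS : x ∉ S := fun hxS => by
      obtain ⟨b, hb, hsubb⟩ := hucov x hxS
      exact hxU (mem_biUnion hb (hsubb (mem_ball_self (hr0 x hxS))))
    have hle : |f x - c| ≤ lam := by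
      refine le_of_tendsto' hx fun k => ?_
      have hnP : ¬ P x k := fun hP => hxS ⟨hxB, k, hP⟩
      simp only [P, not_lt] at hnP
      have hpos := volume_real_ball_pos x (by positivity : 0 < R * (1 / 2 : ℝ) ^ k)
      rw [setAverage_eq, smul_eq_mul, inv_mul_le_iff₀ hpos]
      linarith
    refine hle.trans ?_
    have h2 : (1 : ℝ) ≤ 2 ^ d := one_le_pow₀ (by norm_num)
    have h5 : (0 : ℝ) < 5 ^ d := by positivity
    rw [stoppingConst, hlam, ← hA]
    have : 0 < 2 * 5 ^ d * A := by positivity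
    refine mul_le_mul_of_nonneg_right ?_ hN.le
    nlinarith

/-- The enlarged balls may overlap; giving each point to the first ball containing it makes the
integrals add up. -/
theorem exists_measurable_disjoint_refinement {α ι : Type*} [MeasurableSpace α] [Countable ι]
    (B : ι → Set α) (hB : ∀ i, MeasurableSet (B i)) :
    ∃ D : ι → Set α, (∀ i, MeasurableSet (D i)) ∧ (∀ i, D i ⊆ B i) ∧
      Pairwise (Function.onFun Disjoint D) ∧ ⋃ i, D i = ⋃ i, B i := by
  classical
  have := Encodable.ofCountable ι
  refine ⟨fun i => B i \ ⋃ j, ⋃ _ : Encodable.encode j < Encodable.encode i, B j,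
    fun i => (hB i).diff (.iUnion fun j => .iUnion fun _ => hB j), fun i => sdiff_subset, ?_, ?_⟩
  · intro i j hij
    rw [Function.onFun, Set.disjoint_left]
    rintro x ⟨hxi, hxi'⟩ ⟨hxj, hxj'⟩
    simp only [mem_iUnion, not_exists] at hxi' hxj'
    rcases lt_trichotomy (Encodable.encode i) (Encodable.encode j) with hlt | heq | hlt
    · exact hxj' i hlt hxi
    · exact hij (Encodable.encode_injective heq)
    · exact hxi' j hlt hxj
  · refine Subset.antisymm (iUnion_mono fun i => sdiff_subset) fun x hx => ?_
    have hex : ∃ n, ∃ i, Encodable.encode i = n ∧ x ∈ B i := by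
      obtain ⟨i, hi⟩ := mem_iUnion.1 hx
      exact ⟨_, i, rfl, hi⟩
    obtain ⟨i, hi, hxi⟩ := Nat.find_spec hex
    refine mem_iUnion.2 ⟨i, hxi, ?_⟩
    simp only [mem_iUnion, not_exists]
    intro j hj hxj
    exact Nat.find_min hex (hi ▸ hj) ⟨j, rfl, hxj⟩

theorem setLIntegral_enorm_sub_le {s : Set (Eucl d)} {g : Eucl d → ℝ}
    (a b : ℝ) :
    ∫⁻ y in s, ‖g y - b‖ₑ ≤ (∫⁻ y in s, ‖g y - a‖ₑ) + ENNReal.ofReal |a - b| * volume s := by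
  calc ∫⁻ y in s, ‖g y - b‖ₑ ≤ ∫⁻ y in s, (‖g y - a‖ₑ + ENNReal.ofReal |a - b|) := by
        refine lintegral_mono fun y => ?_
        rw [← Real.norm_eq_abs, ofReal_norm]
        have : g y - b = (g y - a) + (a - b) := by ring
        rw [this]
        exact enorm_add_le _ _
    _ = _ := by rw [lintegral_add_right _ measurable_const, setLIntegral_const]

/-- Iterated John–Nirenberg estimate for the integral of the oscillation over a subset
of a ball. -/
theorem MeanOscLE.setLIntegral_le {N : ℝ} (hN : 0 < N) (h : MeanOscLE f 0 N)
    (hf : LocallyIntegrable f) (n : ℕ) :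
    ∀ (x₀ : Eucl d) (R : ℝ), 0 < R → ∀ E : Set (Eucl d), MeasurableSet E → E ⊆ ball x₀ R →
      ∫⁻ y in E, ‖f y - ⨍ z in ball x₀ R, f z‖ₑ ≤
        ENNReal.ofReal (stoppingConst d * N) * n * volume E +
          ENNReal.ofReal N * (2⁻¹ ^ n * volume (ball x₀ R)) := by
  induction n with
  | zero =>
    intro x₀ R hR E hE hEB
    refine (lintegral_mono_set hEB).trans ?_
    rw [← hf.ofReal_setIntegral_abs_sub Subset.rfl]
    have := h x₀ R hR
    rw [Real.rpow_zero, mul_one] at this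
    refine (ENNReal.ofReal_le_ofReal this).trans ?_
    rw [ENNReal.ofReal_mul hN.le, ofReal_measureReal measure_ball_lt_top.ne]
    simp
  | succ n ih =>
    intro x₀ R hR E hE hEB
    obtain ⟨u, ρ, hu, hρ, hsum, havg, hae⟩ := h.exists_stopping_balls hN hf x₀ hR
    have := hu.to_subtype
    obtain ⟨D, hDm, hDsub, hDdisj, hDU⟩ := exists_measurable_disjoint_refinement
      (fun b : u => ball (b : Eucl d) (ρ b)) fun _ => measurableSet_ball
    set c := ⨍ z in ball x₀ R, f z
    set M := ENNReal.ofReal (stoppingConst d * N)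
    set U := ⋃ b : u, ball (b : Eucl d) (ρ b) with hU
    have hUm : MeasurableSet U := .iUnion fun _ => measurableSet_ball
    have hEU : E ∩ U = ⋃ b : u, E ∩ D b := by rw [← inter_iUnion, hDU]
    have hEDm : ∀ b : u, MeasurableSet (E ∩ D b) := fun b => hE.inter (hDm b)
    have hEDd : Pairwise (Function.onFun Disjoint fun b : u => E ∩ D b) := fun i j hij =>
      (hDdisj hij).mono inter_subset_right inter_subset_right
    have hout : ∫⁻ y in E \ U, ‖f y - c‖ₑ ≤ M * volume (E \ U) := by
      rw [← setLIntegral_const]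
      refine setLIntegral_mono_ae measurable_const.aemeasurable ?_
      filter_upwards [hae] with y hy hyE
      rw [← ofReal_norm, Real.norm_eq_abs]
      refine ENNReal.ofReal_le_ofReal (hy (hEB hyE.1) ?_)
      rw [biUnion_eq_iUnion]
      exact hyE.2
    -- Induction is applied to `E ∩ D b` inside the stopping ball, which is why `E` is arbitrary.
    -- Passing from that ball's average to `c` adds one `M` per unit volume, and the balls have at
    -- most half the volume of `ball x₀ R`.
    have hin : ∫⁻ y in E ∩ U, ‖f y - c‖ₑ ≤ M * (n + 1) * volume (E ∩ U) +
        ENNReal.ofReal N * (2⁻¹ ^ (n + 1) * volume (ball x₀ R)) := by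
      have hvol : ∑' b : u, volume (E ∩ D b) = volume (E ∩ U) := by
        rw [hEU, measure_iUnion hEDd hEDm]
      calc ∫⁻ y in E ∩ U, ‖f y - c‖ₑ = ∑' b : u, ∫⁻ y in E ∩ D b, ‖f y - c‖ₑ := by
            rw [hEU, lintegral_iUnion hEDm hEDd]
        _ ≤ ∑' b : u, (M * (n + 1) * volume (E ∩ D b) +
              ENNReal.ofReal N * 2⁻¹ ^ n * volume (ball (b : Eucl d) (ρ b))) := by
            refine ENNReal.tsum_le_tsum fun b => ?_
            refine (setLIntegral_enorm_sub_le
              (⨍ z in ball (b : Eucl d) (ρ b), f z) c).trans ?_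
            refine (add_le_add (ih b (ρ b) (hρ b b.2) (E ∩ D b) (hEDm b)
              (inter_subset_right.trans (hDsub b)))
              (mul_le_mul_left (ENNReal.ofReal_le_ofReal (havg b b.2)) _)).trans_eq ?_
            ring
        _ = M * (n + 1) * volume (E ∩ U) + ENNReal.ofReal N * 2⁻¹ ^ n *
              ∑' b : u, volume (ball (b : Eucl d) (ρ b)) := by
            rw [ENNReal.tsum_add, ENNReal.tsum_mul_left, ENNReal.tsum_mul_left, hvol]
        _ ≤ M * (n + 1) * volume (E ∩ U) + ENNReal.ofReal N * 2⁻¹ ^ n *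
              (volume (ball x₀ R) / 2) := by gcongr
        _ = _ := by rw [pow_succ, ENNReal.div_eq_inv_mul]; ring
    rw [← lintegral_inter_add_sdiff _ E hUm, ← measure_inter_add_sdiff E hUm]
    calc _ ≤ _ := add_le_add hin hout
      _ ≤ (M * (n + 1) * volume (E ∩ U) +
          ENNReal.ofReal N * (2⁻¹ ^ (n + 1) * volume (ball x₀ R))) +
            M * (n + 1) * volume (E \ U) := by
          gcongr
          exact le_mul_of_one_le_right' (by simp)
      _ = _ := by push_cast; ring

end JohnNirenberg

/-! ### Composition with volume-preserving Lipschitz homeomorphisms. -/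

section Transport

open Filter Topology

open Metric

variable {d : ℕ} {f : Eucl d → ℝ}

theorem sharpNorm_congr {p a : ℝ} {f g : Eucl d → ℝ} (h : f =ᵐ[volume] g) :
    sharpNorm p a f = sharpNorm p a g := by
  unfold sharpNorm
  refine iSup_congr fun x => iSup_congr fun r => iSup_congr fun _ => ?_
  have h1 : ⨍ z in ball x r, f z = ⨍ z in ball x r, g z :=
    setAverage_congr_fun measurableSet_ball (h.mono fun y hy _ => hy)
  rw [h1]
  congr 2
  refine lintegral_congr_ae ?_
  filter_upwards [ae_restrict_of_ae h] with y hy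
  rw [hy]

theorem volume_ball_rpow (hd : 1 ≤ d) (x : Eucl d) {r : ℝ} (hr : 0 < r) (a : ℝ) :
    volume (ball x r) ^ (a / d) =
      ENNReal.ofReal (volume.real (ball (0 : Eucl d) 1) ^ (a / d) * r ^ a) := by
  have h0 := volume_real_ball_pos (0 : Eucl d) one_pos
  have h1 : volume.real (ball x r) = r ^ d * volume.real (ball (0 : Eucl d) 1) := by
    simpa using volume_real_ball_mul x 0 hr one_pos
  have hd' : (d : ℝ) ≠ 0 := by positivity
  rw [← ofReal_measureReal measure_ball_lt_top.ne, h1,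
    ENNReal.ofReal_rpow_of_pos (by positivity), Real.mul_rpow (by positivity) h0.le,
    ← Real.rpow_natCast_mul hr.le, mul_div_cancel₀ _ hd', mul_comm]

/-- Hölder reduces to first-order oscillation. For `a > 0` nothing is lost, as Campanato's bound is
pointwise and returns any exponent `p`. -/
theorem meanOscLE_of_sharpNorm_le (hd : 1 ≤ d) {p a N : ℝ} (hp : 1 ≤ p) (hN : 0 ≤ N)
    (hf : LocallyIntegrable f) (h : sharpNorm p a f ≤ ENNReal.ofReal N) :
    MeanOscLE f a (N * volume.real (ball (0 : Eucl d) 1) ^ (a / d)) := by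
  intro x r hr
  set c := ⨍ z in ball x r, f z
  set m := volume (ball x r) with hm
  have hm0 : m ≠ 0 := (measure_ball_pos _ _ hr).ne'
  have hmt : m ≠ ⊤ := measure_ball_lt_top.ne
  have hp0 : 0 < p := by linarith
  have hd' : (d : ℝ) ≠ 0 := by positivity
  set J := ∫⁻ y in ball x r, ‖f y - c‖ₑ ^ p with hJ
  have h1 : (m ^ (-(1 + a * p / (d : ℝ))) * J) ^ (1 / p) ≤ ENNReal.ofReal N := by
    refine le_trans ?_ h
    unfold sharpNorm
    exact le_iSup_of_le x (le_iSup_of_le r (le_iSup_of_le hr le_rfl))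
  have hJN : J ^ (1 / p) ≤ ENNReal.ofReal N * m ^ (1 / p + a / d) := by
    have e : m ^ (1 / p + a / d) * (m ^ (-(1 + a * p / (d : ℝ))) * J) ^ (1 / p) = J ^ (1 / p) := by
      rw [ENNReal.mul_rpow_of_nonneg _ _ (by positivity), ← ENNReal.rpow_mul, ← mul_assoc,
        ← ENNReal.rpow_add _ _ hm0 hmt]
      have : 1 / p + a / d + -(1 + a * p / d) * (1 / p) = 0 := by field_simp; ring
      rw [this, ENNReal.rpow_zero, one_mul]
    rw [← e, mul_comm]
    gcongr
  have hmeas : AEStronglyMeasurable (fun y => f y - c) (volume.restrict (ball x r)) :=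
    (hf.aestronglyMeasurable.sub aestronglyMeasurable_const).restrict
  have hHol := eLpNorm'_le_eLpNorm'_mul_rpow_measure_univ one_pos hp hmeas
  simp only [eLpNorm', ENNReal.rpow_one, div_one, Measure.restrict_apply_univ] at hHol
  have hpos := volume_real_ball_pos x hr
  have hκ := volume_real_ball_pos (0 : Eucl d) one_pos
  have key : ∫⁻ y in ball x r, ‖f y - c‖ₑ ≤
      ENNReal.ofReal (N * volume.real (ball (0 : Eucl d) 1) ^ (a / d) * r ^ a *
        volume.real (ball x r)) := by
    calc ∫⁻ y in ball x r, ‖f y - c‖ₑ ≤ J ^ (1 / p) * m ^ (1 - 1 / p) := hHol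
      _ ≤ ENNReal.ofReal N * m ^ (1 / p + a / d) * m ^ (1 - 1 / p) := by gcongr
      _ = ENNReal.ofReal N * (m ^ (a / d) * m) := by
          rw [mul_assoc, ← ENNReal.rpow_add _ _ hm0 hmt]
          nth_rw 3 [← ENNReal.rpow_one m]
          rw [← ENNReal.rpow_add _ _ hm0 hmt]
          congr 2; ring
      _ = _ := by
          rw [hm, volume_ball_rpow hd x hr a, ← ofReal_measureReal measure_ball_lt_top.ne,
            ← ENNReal.ofReal_mul (by positivity), ← ENNReal.ofReal_mul hN]
          congr 1; ring
  rw [← hf.ofReal_setIntegral_abs_sub Subset.rfl] at key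
  exact (ENNReal.ofReal_le_ofReal_iff (by positivity)).1 key

/-- Replacing the average by another constant at most doubles the oscillation. -/
theorem setLIntegral_enorm_sub_setAverage_le (hf : LocallyIntegrable f) (x : Eucl d) {r : ℝ}
    (hr : 0 < r) (c : ℝ) :
    ∫⁻ y in ball x r, ‖f y - ⨍ z in ball x r, f z‖ₑ ≤ 2 * ∫⁻ y in ball x r, ‖f y - c‖ₑ := by
  have hpos := volume_real_ball_pos x hr
  have h1 := abs_setAverage_sub_le (measure_ball_pos volume x hr).ne' measure_ball_lt_top.ne
    (hf.integrableOn_ball x r) c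
  refine (setLIntegral_enorm_sub_le c _).trans ?_
  rw [two_mul]
  gcongr
  rw [← hf.ofReal_setIntegral_abs_sub Subset.rfl, ← ofReal_measureReal measure_ball_lt_top.ne,
    ← ENNReal.ofReal_mul (abs_nonneg _)]
  refine ENNReal.ofReal_le_ofReal ?_
  rw [abs_sub_comm, mul_comm]
  exact (le_inv_mul_iff₀ hpos).1 h1

theorem exp_mul_half_pow_ceil_le_one (s : ℝ) :
    Real.exp s * (1 / 2) ^ ⌈2 * s⌉₊ ≤ 1 := by
  have h1 : s ≤ ⌈2 * s⌉₊ * Real.log 2 := by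
    have := Nat.le_ceil (2 * s)
    have hl : (1 / 2 : ℝ) ≤ Real.log 2 := by linarith [Real.log_two_gt_d9]
    nlinarith
  have h2 : Real.exp s ≤ 2 ^ ⌈2 * s⌉₊ := by
    rw [← Real.exp_log (by positivity : (0 : ℝ) < 2 ^ ⌈2 * s⌉₊), Real.log_pow]
    exact Real.exp_le_exp.2 h1
  rw [one_div, inv_pow, ← div_eq_mul_inv, div_le_one (by positivity)]
  exact h2

/-- The constant in the composition estimate for `BMO`. -/
noncomputable def bmoConst (d : ℕ) : ℝ := 2 * (stoppingConst d * (2 * d + 1) + 1)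

theorem stoppingConst_pos (d : ℕ) : 0 < stoppingConst d := by
  unfold stoppingConst; positivity

theorem bmoConst_pos (d : ℕ) : 0 < bmoConst d := by
  have := stoppingConst_pos d
  unfold bmoConst; positivity

/-- The image of a ball keeps its volume, and the factor `e^{ds}` of the enclosing ball enters only
the term carrying `2^{-n}`. Positivity of `N` makes the stopping height positive. -/
theorem bmoNorm_comp_le_of_pos (hd : 1 ≤ d) (hf : LocallyIntegrable f) (Φ : Eucl d ≃ₜ Eucl d)
    (hΦ : MeasurePreserving Φ) {s : ℝ} (hs : 0 ≤ s)
    (hlip : ∀ x y, dist (Φ x) (Φ y) ≤ Real.exp s * dist x y) {N : ℝ} (hN : 0 < N)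
    (h : bmoNorm f ≤ ENNReal.ofReal N) :
    bmoNorm (fun x => f (Φ x)) ≤ ENNReal.ofReal (bmoConst d * (1 + s) * N) := by
  have hosc : MeanOscLE f 0 N := by
    simpa using meanOscLE_of_sharpNorm_le hd le_rfl hN.le hf h
  have hg : LocallyIntegrable fun x => f (Φ x) := hf.comp_homeomorph Φ hΦ
  have hst := stoppingConst_pos d
  refine iSup_le fun x => iSup_le fun r => iSup_le fun hr => ?_
  set m := volume (ball x r) with hm
  have hm0 : m ≠ 0 := (measure_ball_pos _ _ hr).ne'
  have hmt : m ≠ ⊤ := measure_ball_lt_top.ne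
  simp only [zero_mul, zero_div, add_zero, ENNReal.rpow_one, div_one, ENNReal.rpow_neg_one]
  rw [ENNReal.inv_mul_le_iff hm0 hmt]
  set c := ⨍ z in ball (Φ x) (Real.exp s * r), f z
  refine (setLIntegral_enorm_sub_setAverage_le hg x hr c).trans ?_
  -- Since `log 2 ≥ 1/2`, this many halvings cancel `e^{ds}`; the price is the factor `n ≤ 2ds + 1`.
  set n := ⌈2 * (d * s)⌉₊
  have hE : MeasurableSet (Φ '' ball x r) := Φ.measurableEmbedding.measurableSet_image.2
    measurableSet_ball
  have hEvol : volume (Φ '' ball x r) = m := by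
    rw [← hΦ.measure_preimage hE.nullMeasurableSet, Φ.injective.preimage_image]
  have hEsub : Φ '' ball x r ⊆ ball (Φ x) (Real.exp s * r) := by
    rintro _ ⟨y, hy, rfl⟩
    rw [mem_ball] at hy ⊢
    refine (hlip y x).trans_lt ?_
    gcongr
  have hJN := hosc.setLIntegral_le hN hf n (Φ x) _ (by positivity) _ hE hEsub
  rw [← hΦ.setLIntegral_comp_emb Φ.measurableEmbedding, hEvol,
    volume_ball_mul (Φ x) x (Real.exp_pos s) hr] at hJN
  have hpow : (2⁻¹ : ℝ≥0∞) ^ n * (ENNReal.ofReal (Real.exp s ^ d) * m) ≤ m := by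
    rw [← mul_assoc]
    refine mul_le_of_le_one_left' ?_
    have h2 : (2⁻¹ : ℝ≥0∞) = ENNReal.ofReal (1 / 2) := by
      rw [one_div, ENNReal.ofReal_inv_of_pos two_pos]; simp
    rw [h2, ← ENNReal.ofReal_pow (by positivity), ← ENNReal.ofReal_mul (by positivity),
      ENNReal.ofReal_le_one, ← Real.exp_nat_mul, mul_comm]
    exact exp_mul_half_pow_ceil_le_one _
  have hn : (n : ℝ) ≤ 2 * (d * s) + 1 := (Nat.ceil_lt_add_one (by positivity)).le
  calc 2 * ∫⁻ y in ball x r, ‖f (Φ y) - c‖ₑ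
      ≤ 2 * (ENNReal.ofReal (stoppingConst d * N) * n * m + ENNReal.ofReal N * m) := by
        gcongr
        refine hJN.trans ?_
        gcongr
    _ = ENNReal.ofReal (2 * (stoppingConst d * n + 1) * N) * m := by
        have e1 : (n : ℝ≥0∞) = ENNReal.ofReal n := (ENNReal.ofReal_natCast n).symm
        have e2 : (2 : ℝ≥0∞) = ENNReal.ofReal 2 := by simp
        rw [e1, ← ENNReal.ofReal_mul (by positivity), ← add_mul, ← mul_assoc, e2,
          ← ENNReal.ofReal_add (by positivity) hN.le, ← ENNReal.ofReal_mul (by positivity)]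
        congr 2; ring
    _ ≤ ENNReal.ofReal (bmoConst d * (1 + s) * N) * m := by
        refine mul_le_mul_left (ENNReal.ofReal_le_ofReal (mul_le_mul_of_nonneg_right ?_ hN.le)) _
        rw [bmoConst]
        have : stoppingConst d * n ≤ stoppingConst d * (2 * (d * s) + 1) := by gcongr
        have h3 : 0 ≤ stoppingConst d * d := by positivity
        have h4 : 0 ≤ stoppingConst d * s := by positivity
        nlinarith
    _ = _ := mul_comm _ _

/-- Composition with a measure-preserving homeomorphism with Lipschitz constant `exp s` is bounded
on `BMO` with a bound linear in `s`. -/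
theorem bmoNorm_comp_le (hd : 1 ≤ d) (hf : MemBMO f) (Φ : Eucl d ≃ₜ Eucl d)
    (hΦ : MeasurePreserving Φ) {s : ℝ} (hs : 0 ≤ s)
    (hlip : ∀ x y, dist (Φ x) (Φ y) ≤ Real.exp s * dist x y) :
    bmoNorm (fun x => f (Φ x)) ≤ ENNReal.ofReal (bmoConst d * (1 + s)) * bmoNorm f := by
  have hb := bmoConst_pos d
  have key : ∀ ε : ℝ, 0 < ε → bmoNorm (fun x => f (Φ x)) ≤
      ENNReal.ofReal (bmoConst d * (1 + s) * ((bmoNorm f).toReal + ε)) := fun ε hε =>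
    bmoNorm_comp_le_of_pos hd hf.1 Φ hΦ hs hlip (add_pos_of_nonneg_of_pos ENNReal.toReal_nonneg hε)
      (by
        conv_lhs => rw [← ENNReal.ofReal_toReal hf.2.ne]
        exact ENNReal.ofReal_le_ofReal (by linarith))
  -- The slack `ε` admits seminorm zero and is removed in the limit.
  have hlim : Tendsto (fun ε : ℝ => ENNReal.ofReal
      (bmoConst d * (1 + s) * ((bmoNorm f).toReal + ε))) (𝓝[>] 0)
      (𝓝 (ENNReal.ofReal (bmoConst d * (1 + s) * ((bmoNorm f).toReal + 0)))) :=
    (Continuous.tendsto (ENNReal.continuous_ofReal.comp (by fun_prop)) (0 : ℝ)).mono_left nhdsWithin_le_nhds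
  refine (ge_of_tendsto hlim (eventually_nhdsWithin_of_forall key)).trans_eq ?_
  rw [add_zero, ENNReal.ofReal_mul (by positivity), ENNReal.ofReal_toReal hf.2.ne]

/-- The constant in the composition estimate for `Lip_p(a)`. -/
noncomputable def lipConst (d : ℕ) (a : ℝ) : ℝ :=
  2 * (2 ^ d / (1 - (1 / 2) ^ a) + 2 ^ d * 2 ^ a)

theorem lipConst_pos (d : ℕ) {a : ℝ} (ha : 0 < a) : 0 < lipConst d a := by
  have : 0 < 1 - (1 / 2 : ℝ) ^ a :=
    sub_pos.2 (Real.rpow_lt_one (by norm_num) (by norm_num) ha)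
  unfold lipConst; positivity

/-- Composition with a measure-preserving homeomorphism with Lipschitz constant `exp s` is bounded
on `Lip_p(a)` with a bound `O(exp (a s))`. -/
theorem sharpNorm_comp_le (hd : 1 ≤ d) {p a : ℝ} (hp : 1 ≤ p) (ha : 0 < a)
    (hf : MemLipSpace p a f) (Φ : Eucl d ≃ₜ Eucl d)
    (hΦ : MeasurePreserving Φ) {s : ℝ}
    (hlip : ∀ x y, dist (Φ x) (Φ y) ≤ Real.exp s * dist x y) :
    sharpNorm p a (fun x => f (Φ x)) ≤
      ENNReal.ofReal (lipConst d a * Real.exp (a * s)) * sharpNorm p a f := by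
  set N := (sharpNorm p a f).toReal with hNdef
  have hN : 0 ≤ N := ENNReal.toReal_nonneg
  have hNe : sharpNorm p a f = ENNReal.ofReal N := (ENNReal.ofReal_toReal hf.2.ne).symm
  have hosc := meanOscLE_of_sharpNorm_le hd hp hN hf.1 hNe.le
  have hg : LocallyIntegrable fun x => f (Φ x) := hf.1.comp_homeomorph Φ hΦ
  have hc := lipConst_pos d ha
  have hp0 : 0 < p := by linarith
  have hd' : (d : ℝ) ≠ 0 := by positivity
  have hκ := volume_real_ball_pos (0 : Eucl d) one_pos
  set κ := volume.real (ball (0 : Eucl d) 1) with hκdef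
  rw [hNe]
  refine iSup_le fun x => iSup_le fun r => iSup_le fun hr => ?_
  set m := volume (ball x r) with hm
  have hm0 : m ≠ 0 := (measure_ball_pos _ _ hr).ne'
  have hmt : m ≠ ⊤ := measure_ball_lt_top.ne
  have hpos := volume_real_ball_pos x hr
  set c := ⨍ z in ball (Φ x) (2 * (Real.exp s * r)), f z
  set M : ℝ := lipConst d a * (N * κ ^ (a / d) * (Real.exp s * r) ^ a) with hM
  have hM0 : 0 ≤ M := by positivity
  -- `Φ` maps the ball into `ball (Φ x) (e^s r)`, where Campanato's bound holds. One half of `M` is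
  -- for the deviation from `c`, the other for replacing `c` by the average.
  have hae : ∀ᵐ y, y ∈ ball x r → |f (Φ y) - c| ≤ M / 2 := by
    have h1 := hΦ.quasiMeasurePreserving.ae
      (hosc.ae_abs_sub_setAverage_le ha hf.1 (Φ x) (R := Real.exp s * r) (by positivity))
    filter_upwards [h1] with y hy hyB
    refine (hy ?_).trans_eq ?_
    · rw [mem_ball] at hyB ⊢
      refine (hlip y x).trans_lt ?_
      gcongr
    · rw [hM, lipConst]; ring
  set g : Eucl d → ℝ := fun y => f (Φ y)
  have havg : |(⨍ y in ball x r, g y) - c| ≤ M / 2 := by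
    refine (abs_setAverage_sub_le hm0 hmt (hg.integrableOn_ball x r) c).trans ?_
    rw [inv_mul_le_iff₀ hpos]
    calc ∫ y in ball x r, |g y - c| ≤ ∫ y in ball x r, M / 2 :=
          setIntegral_mono_on_ae (hg.integrableOn_ball_abs_sub x r c) (integrableOn_const hmt)
            measurableSet_ball hae
      _ = _ := by rw [setIntegral_const, smul_eq_mul]
  have hJ : ∫⁻ y in ball x r, ‖g y - ⨍ z in ball x r, g z‖ₑ ^ p ≤ ENNReal.ofReal M ^ p * m := by
    rw [← setLIntegral_const]
    refine setLIntegral_mono_ae measurable_const.aemeasurable ?_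
    filter_upwards [hae] with y hy hyB
    gcongr
    rw [← ofReal_norm, Real.norm_eq_abs]
    refine ENNReal.ofReal_le_ofReal ((abs_sub_le _ c _).trans ?_)
    rw [abs_sub_comm c]
    linarith [hy hyB]
  calc (m ^ (-(1 + a * p / (d : ℝ))) * ∫⁻ y in ball x r, ‖g y - ⨍ z in ball x r, g z‖ₑ ^ p) ^
        (1 / p)
      ≤ (m ^ (-(1 + a * p / (d : ℝ))) * (ENNReal.ofReal M ^ p * m)) ^ (1 / p) := by gcongr
    _ = ENNReal.ofReal M * (m ^ (a / d))⁻¹ := by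
        have e : m ^ (-(1 + a * p / (d : ℝ))) * (ENNReal.ofReal M ^ p * m) =
            ENNReal.ofReal M ^ p * m ^ (-(a * p / (d : ℝ))) := by
          nth_rw 2 [← ENNReal.rpow_one m]
          rw [mul_left_comm, ← ENNReal.rpow_add _ _ hm0 hmt]
          congr 2; ring
        rw [e, ENNReal.mul_rpow_of_nonneg _ _ (by positivity), ← ENNReal.rpow_mul,
          ← ENNReal.rpow_mul, ← ENNReal.rpow_neg, mul_one_div_cancel hp0.ne', ENNReal.rpow_one]
        congr 2; field_simp
    _ = ENNReal.ofReal (lipConst d a * Real.exp (a * s)) * ENNReal.ofReal N := by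
        rw [hm, volume_ball_rpow hd x hr a, ← hκdef, ← ENNReal.ofReal_inv_of_pos (by positivity),
          ← ENNReal.ofReal_mul hM0, ← ENNReal.ofReal_mul (by positivity)]
        congr 1
        rw [hM, Real.mul_rpow (Real.exp_pos s).le hr.le, ← Real.exp_mul, mul_comm s a]
        have h1 : κ ^ (a / d) ≠ 0 := by positivity
        have h2 : r ^ a ≠ 0 := by positivity
        field_simp

end Transport

/-! ### Conclusion for the transport equation. -/

theorem theorem4 (d : ℕ) (hd : 1 ≤ d) :
    -- the transport equation has a unique solution, and it has values at every time `t ≥ 0`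
    (∀ (v : Eucl d → Eucl d) (u₀ : Eucl d → ℝ),
      IsLipschitzDivFree v → LocallyIntegrable u₀ →
        (∃ u : ℝ → Eucl d → ℝ, IsWeakSolution v u₀ u ∧ IsWeaklyContinuous u) ∧
        (∀ u w : ℝ → Eucl d → ℝ, IsWeakSolution v u₀ u → IsWeakSolution v u₀ w →
          (fun z : ℝ × Eucl d => u z.1 z.2) =ᵐ[volume.restrict (spaceTime d)]
            fun z : ℝ × Eucl d => w z.1 z.2)) ∧
    -- `BMO` data
    (∃ C : ℝ≥0, ∀ (v : Eucl d → Eucl d) (u₀ : Eucl d → ℝ) (u : ℝ → Eucl d → ℝ),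
      IsLipschitzDivFree v → MemBMO u₀ → IsWeakSolution v u₀ u → IsWeaklyContinuous u →
        (∀ t : ℝ, 0 ≤ t → MemBMO (u t)) ∧
        (∀ T : ℝ, 0 ≤ T → (⨆ t ∈ Icc (0 : ℝ) T, bmoNorm (u t)) < ⊤) ∧
        (∀ t : ℝ, 0 ≤ t →
          bmoNorm (u t) ≤ C * ENNReal.ofReal (1 + lipNorm v * t) * bmoNorm u₀)) ∧
    -- `Lip_p(a)` data
    (∀ a p : ℝ, 0 < a → a ≤ 1 → 1 < p →
      ∃ C : ℝ≥0, ∀ (v : Eucl d → Eucl d) (u₀ : Eucl d → ℝ) (u : ℝ → Eucl d → ℝ),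
        IsLipschitzDivFree v → MemLipSpace p a u₀ →
        IsWeakSolution v u₀ u → IsWeaklyContinuous u →
          (∀ t : ℝ, 0 ≤ t → MemLipSpace p a (u t)) ∧
          (∀ T : ℝ, 0 ≤ T → (⨆ t ∈ Icc (0 : ℝ) T, sharpNorm p a (u t)) < ⊤) ∧
          (∀ t : ℝ, 0 ≤ t → sharpNorm p a (u t) ≤
            C * ENNReal.ofReal (Real.exp (a * lipNorm v * t)) * sharpNorm p a u₀)) := by
  refine ⟨fun v u₀ hv hu₀ => ?_, ?_, fun a p ha _ hp => ?_⟩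
  · obtain ⟨X, hX⟩ := exists_isFlow (lipschitzWith_lipNorm hv.lipschitz)
    exact ⟨⟨_, hX.isWeakSolution hv hu₀, hX.isWeaklyContinuous hv hu₀⟩,
      fun u w hu hw => hu.ae_eq hv hw⟩
  · refine ⟨(bmoConst d).toNNReal, fun v u₀ u hv hu₀ hu hc => ?_⟩
    have hL := lipschitzWith_lipNorm hv.lipschitz
    obtain ⟨X, hX⟩ := exists_isFlow hL
    have bound : ∀ t : ℝ, 0 ≤ t → bmoNorm (u t) ≤
        (bmoConst d).toNNReal * ENNReal.ofReal (1 + lipNorm v * t) * bmoNorm u₀ := by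
      intro t ht
      have h := bmoNorm_comp_le hd hu₀ (hX.homeomorph hL t) (hX.measurePreserving hv t)
        (s := lipNorm v * t) (by positivity) (hX.dist_le_of_nonneg hL ht)
      rw [ENNReal.ofReal_mul (bmoConst_pos d).le] at h
      rw [bmoNorm, sharpNorm_congr (hu.ae_eq_comp_flow hv hX hu₀.1 hc ht)]
      exact h
    refine ⟨fun t ht => ⟨hc.locallyIntegrable t ht, (bound t ht).trans_lt ?_⟩, fun T hT => ?_, bound⟩
    · exact ENNReal.mul_lt_top (by finiteness) hu₀.2
    · refine lt_of_le_of_lt (iSup₂_le fun t ht => (bound t ht.1).trans ?_)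
        (ENNReal.mul_lt_top (a := (bmoConst d).toNNReal * ENNReal.ofReal (1 + lipNorm v * T))
          (by finiteness) hu₀.2)
      gcongr
      exact ht.2
  · refine ⟨(lipConst d a).toNNReal, fun v u₀ u hv hu₀ hu hc => ?_⟩
    have hL := lipschitzWith_lipNorm hv.lipschitz
    obtain ⟨X, hX⟩ := exists_isFlow hL
    have bound : ∀ t : ℝ, 0 ≤ t → sharpNorm p a (u t) ≤
        (lipConst d a).toNNReal * ENNReal.ofReal (Real.exp (a * lipNorm v * t)) *
          sharpNorm p a u₀ := by
      intro t ht
      have h := sharpNorm_comp_le hd hp.le ha hu₀ (hX.homeomorph hL t) (hX.measurePreserving hv t)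
        (s := lipNorm v * t) (hX.dist_le_of_nonneg hL ht)
      rw [ENNReal.ofReal_mul (lipConst_pos d ha).le, ← mul_assoc a] at h
      rw [sharpNorm_congr (hu.ae_eq_comp_flow hv hX hu₀.1 hc ht)]
      exact h
    refine ⟨fun t ht => ⟨hc.locallyIntegrable t ht, (bound t ht).trans_lt ?_⟩, fun T hT => ?_, bound⟩
    · exact ENNReal.mul_lt_top (by finiteness) hu₀.2
    · refine lt_of_le_of_lt (iSup₂_le fun t ht => (bound t ht.1).trans ?_)
        (ENNReal.mul_lt_top
          (a := (lipConst d a).toNNReal * ENNReal.ofReal (Real.exp (a * lipNorm v * T)))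
          (by finiteness) hu₀.2)
      gcongr
      exact ht.2
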